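/- Let $X$ be a non-empty compact metric space, let $f : X \to X$ be continuous with finite topological entropy $h_{\mathrm{top}}(f) < +\infty$, and let $\varphi : X \to \mathbb{R}$ be continuous. For $\psi \in C(X)$ let $P_{\mathrm{top}}(f,\psi)$ be the topological pressure, $P_{\mathrm{top}}(f,\psi) = \lim_{\varepsilon \to 0^+} \limsup_{n \to \infty} \frac1n \log \sup_E \sum_{x \in E} e^{\psi(x) + \psi(f(x)) + \cdots + \psi(f^n(x))}$, where $E$ runs over the $(n,\varepsilon)$-separated sets, i.e. $\max_{0 \le i \le n} d(f^i(x), f^i(z)) \ge \varepsilon$ for all distinct $x, z \in E$. Let $\mathcal{P}_f(X)$ be the set of $f$-invariant Borel probability measures with the weak$^*$ topology, let $h_\mu(f)$ be the Kolmogorov–Sinai metric entropy, and for a Borel probability measure $\mu$ put $$\mathfrak{h}_\mu(f) = \inf_{\psi \in C(X)} \Big\{ P_{\mathrm{top}}(f,\psi) - \int \psi \, d\mu \Big\} \in [-\infty, +\infty).$$ A measure $\mu \in \mathcal{P}_f(X)$ is called an $\mathfrak{h}$-equilibrium state for $\psi$ if $P_{\mathrm{top}}(f,\psi) = \mathfrak{h}_\mu(f)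 + \int \psi \, d\mu$, and $\varphi$-maximizing if $\int \varphi \, d\mu = \max_{\nu \in \mathcal{P}_f(X)} \int \varphi \, d\nu$. Then $\mathfrak{h}_\nu(f)$ is finite for every $\nu \in \mathcal{P}_f(X)$; for every $t > 0$ $$\frac1t P_{\mathrm{top}}(f, t\varphi) = \max_{\nu \in \mathcal{P}_f(X)} \Big\{ \frac1t \mathfrak{h}_\nu(f) + \int \varphi \, d\nu \Big\},$$ the maximum being attained; and $\frac1t P_{\mathrm{top}}(f, t\varphi) \to \max_{\nu \in \mathcal{P}_f(X)} \int \varphi \, d\nu$ as $t \to +\infty$, where this last maximum is attained too. Moreover, let $(\nu_t)_{t>0}$ be any family such that $\nu_t$ is an $\mathfrak{h}$-equilibrium state for $t\varphi$ for each $t > 0$, and let $\nu_\infty$ be any weak$^*$ accumulation point of $(\nu_t)_{t > 0}$ as $t \to +\infty$. Then $\nu_\infty \in \mathcal{P}_f(X)$ and: (a) $\int \varphi \, d\nu_\infty = \max_{\nu \in \mathcal{P}_f(X)} \int \varphi \, d\nu$; (b) $\mathfrak{h}_{\nu_\infty}(f)$ is the maximum of $\mathfrak{h}_\nu(f)$ over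 all $\varphi$-maximizing $\nu \in \mathcal{P}_f(X)$. It is also the maximum over those $\varphi$-maximizing measures that arise as weak$^*$ accumulation points, as $t \to +\infty$, of some family of $\mathfrak{h}$-equilibrium states for $t\varphi$, $t>0$. Moreover $\mathfrak{h}_{\nu_\infty}(f) \ge \sup \{ h_\nu(f) : \nu \in \mathcal{P}_f(X) \text{ is } \varphi\text{-maximizing} \}$; (c) $\lim_{t \to +\infty} \mathfrak{h}_{\nu_t}(f) = \mathfrak{h}_{\nu_\infty}(f)$. -/

import Mathlib

open MeasureTheory Filter Topology

namespace VariationalEntropy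

/-! ### Topological pressure through separated sets -/

section Pressure

variable {X : Type*} [MetricSpace X]

/-- The dynamical distance
`d_n(x, z) = max {d(x, z), d(f x, f z), …, d(f^n x, f^n z)}`. -/
noncomputable def dynDist (f : X → X) (n : ℕ) (x z : X) : ℝ :=
  (Finset.range (n + 1)).sup' Finset.nonempty_range_add_one
    (fun i => dist (f^[i] x) (f^[i] z))

/-- `E` is `(n, ε)`-separated by `f`. (In a compact space such sets are finite when `ε > 0`, so
only finite sets are considered.) -/
def IsSeparated (f : X → X) (n : ℕ) (ε : ℝ) (E : Finset X) : Prop :=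
  ∀ x ∈ E, ∀ z ∈ E, x ≠ z → ε ≤ dynDist f n x z

/-- `P_n(f, φ, ε)`: the supremum of `∑_{x ∈ E} exp (S_n φ (x))` over the `(n, ε)`-separated sets
`E`, where `S_n φ (x) = φ (x) + φ (f x) + ⋯ + φ (f^n x)`. -/
noncomputable def separatedSum (f : X → X) (φ : C(X, ℝ)) (ε : ℝ) (n : ℕ) : ENNReal :=
  ⨆ (E : Finset X) (_ : IsSeparated f n ε E),
    ∑ x ∈ E, ENNReal.ofReal (Real.exp (birkhoffSum f φ (n + 1) x))

/-- `limsup_{n → ∞} (1/n) log P_n(f, φ, ε)`. -/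
noncomputable def pressureAt (f : X → X) (φ : C(X, ℝ)) (ε : ℝ) : EReal :=
  limsup (fun n : ℕ => ENNReal.log (separatedSum f φ ε n) / (n : EReal)) atTop

/-- The topological pressure
`P_top(f, φ) = lim_{ε → 0⁺} limsup_{n → ∞} (1/n) log P_n(f, φ, ε)`. The limit is the supremum over
`ε > 0`, by monotonicity: see `tendsto_pressureAt`. -/
noncomputable def topPressure (f : X → X) (φ : C(X, ℝ)) : EReal :=
  ⨆ (ε : ℝ) (_ : 0 < ε), pressureAt f φ ε

lemma pressureAt_antitone (f : X → X) (φ : C(X, ℝ)) : Antitone (pressureAt f φ) := by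
  intro ε δ h
  refine limsup_le_limsup (Eventually.of_forall fun n => ?_)
  refine EReal.monotone_div_right_of_nonneg (by positivity) (ENNReal.log_monotone ?_)
  exact iSup_le fun E => iSup_le fun hE =>
    le_iSup₂_of_le E (fun x hx z hz hxz => h.trans (hE x hx z hz hxz)) le_rfl

lemma tendsto_pressureAt (f : X → X) (φ : C(X, ℝ)) :
    Tendsto (pressureAt f φ) (𝓝[>] 0) (𝓝 (topPressure f φ)) := by
  refine tendsto_order.2 ⟨fun a ha => ?_, fun a ha => ?_⟩
  · obtain ⟨ε, hε⟩ := lt_iSup_iff.1 ha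
    obtain ⟨h0, hε⟩ := lt_iSup_iff.1 hε
    filter_upwards [Ioo_mem_nhdsGT h0] with δ hδ
    exact hε.trans_le (pressureAt_antitone f φ hδ.2.le)
  · filter_upwards [self_mem_nhdsWithin] with δ hδ
    exact (le_iSup₂ (f := fun (ε : ℝ) (_ : 0 < ε) => pressureAt f φ ε) δ hδ).trans_lt ha

end Pressure

/-! ### Invariant measures and Kolmogorov–Sinai entropy -/

section Measure

variable {X : Type*} [MeasurableSpace X]

/-- The set of `f`-invariant probability measures. -/
def invariantMeasures (f : X → X) : Set (ProbabilityMeasure X) :=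
  {μ | MeasurePreserving f (μ : Measure X) (μ : Measure X)}

/-- The Shannon entropy `-∑_a μ(ξ⁻¹ a) log μ(ξ⁻¹ a)` of the finite partition of `X` into the
fibres of `ξ`. -/
noncomputable def partitionEntropy {α : Type*} [Fintype α] (μ : ProbabilityMeasure X)
    (ξ : X → α) : ℝ :=
  ∑ a, Real.negMulLog ((μ : Measure X).real (ξ ⁻¹' {a}))

/-- The labelling whose fibres form the refined partition
`ξ ∨ f⁻¹ ξ ∨ ⋯ ∨ f^{-(n-1)} ξ`. -/
def itinerary {α : Type*} (f : X → X) (ξ : X → α) (n : ℕ) : X → (Fin n → α) :=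
  fun x i => ξ (f^[i] x)

/-- The entropy of `f` with respect to a finite partition, the growth rate of
`(1/n) H_μ(ξ ∨ f⁻¹ ξ ∨ ⋯ ∨ f^{-(n-1)} ξ)`. For an invariant measure `μ` the upper limit is a
limit. -/
noncomputable def entropyOfPartition {k : ℕ} (f : X → X) (μ : ProbabilityMeasure X)
    (ξ : X → Fin k) : EReal :=
  limsup (fun n : ℕ => ((partitionEntropy μ (itinerary f ξ n) / n : ℝ) : EReal)) atTop

/-- The Kolmogorov–Sinai metric entropy `h_μ(f)`: the supremum over all finite measurable
partitions, given as the fibres of measurable maps to `Fin k`. -/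
noncomputable def metricEntropy (f : X → X) (μ : ProbabilityMeasure X) : EReal :=
  ⨆ (k : ℕ) (ξ : X → Fin k) (_ : Measurable ξ), entropyOfPartition f μ ξ

end Measure

/-! ### The variational entropy and zero-temperature limits -/

section Variational

variable {X : Type*} [MetricSpace X] [MeasurableSpace X]

/-- `𝔥_μ(f) = inf_{φ ∈ C(X)} (P_top(f, φ) - ∫ φ dμ)`. -/
noncomputable def varEntropy (f : X → X) (μ : ProbabilityMeasure X) : EReal :=
  ⨅ φ : C(X, ℝ), (topPressure f φ - ((∫ x, φ x ∂(μ : Measure X) : ℝ) : EReal))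

/-- `μ` is an invariant measure with `P_top(f, φ) = 𝔥_μ(f) + ∫ φ dμ`. -/
def IsEquilibriumState (f : X → X) (φ : C(X, ℝ)) (μ : ProbabilityMeasure X) : Prop :=
  μ ∈ invariantMeasures f ∧
    topPressure f φ = varEntropy f μ + ((∫ x, φ x ∂(μ : Measure X) : ℝ) : EReal)

/-- The `φ`-maximizing invariant probability measures. -/
def maximizingMeasures (f : X → X) (φ : C(X, ℝ)) : Set (ProbabilityMeasure X) :=
  {μ | μ ∈ invariantMeasures f ∧
    ∀ ν ∈ invariantMeasures f, ∫ x, φ x ∂(ν : Measure X) ≤ ∫ x, φ x ∂(μ : Measure X)}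

/-- The `φ`-maximizing invariant probability measures obtained through zero-temperature limits:
weak* accumulation points, as `t → +∞`, of families of equilibrium states for `t φ`. -/
def zeroTempMeasures [OpensMeasurableSpace X] (f : X → X) (φ : C(X, ℝ)) :
    Set (ProbabilityMeasure X) :=
  {μ | μ ∈ maximizingMeasures f φ ∧ ∃ ν : ℝ → ProbabilityMeasure X,
    (∀ t : ℝ, 0 < t → IsEquilibriumState f (t • φ) (ν t)) ∧ MapClusterPt μ atTop ν}

end Variational

end VariationalEntropy

open VariationalEntropy

namespace VariationalEntropy

/-! ### Growth rates -/

/-! The variational entropy 𝔥 is the concave conjugate of the pressure P, so the theorem is convex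
duality with three dynamical inputs.

Existence: P is finite and convex, and P(ψ + g) ≤ P(ψ) + c as soon as the Birkhoff sums of g grow at
most like nc + O(1). A Hahn-Banach subgradient of P at ψ (`exists_subgradient`) is therefore
positive, normalized and `f`-invariant, hence an invariant probability measure by Riesz. The
subgradient inequality says exactly that the infimum defining 𝔥 is attained at ψ, so the measure is
an equilibrium state (`exists_isEquilibriumState`).

Finiteness: on invariant measures h_μ + ∫ ψ dμ ≤ P(ψ) (`metricEntropy_le`), so 0 ≤ h_μ ≤ 𝔥_μ ≤ P(0).
This is a weighted count of itineraries of `f^[N]` against a separated set; it loses a constant per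
block of length N, which disappears as N → ∞.

Limits: 𝔥 is an infimum of weak* continuous functions, hence upper semicontinuous
(`le_varEntropy_of_mapClusterPt`). Since 0 ≤ 𝔥 ≤ P(0), the entropy term is negligible against t ∫ φ,
so accumulation points maximize ∫ φ. Comparing equilibrium states shows that 𝔥 of ν_t is
nonincreasing in t and never below 𝔥 of a maximizing measure. Monotonicity and semicontinuity then
force convergence of the whole family to the value at any accumulation point. -/

lemma log_div_le_coe_iff (s : ENNReal) {n : ℕ} (hn : 0 < n) (b : ℝ) :
    ENNReal.log s / (n : EReal) ≤ (b : EReal) ↔ s ≤ ENNReal.ofReal (Real.exp (n * b)) := by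
  have hn' : (n : EReal) = ((n : ℝ) : EReal) := by simp
  rw [EReal.div_le_iff_le_mul (by exact_mod_cast hn) (by rw [hn']; exact EReal.coe_ne_top _), hn',
    ← EReal.coe_mul, ← ENNReal.log_le_log_iff, ENNReal.log_ofReal_of_pos (Real.exp_pos _),
    Real.log_exp]

/-- Trades extended-real limits for eventual real exponential bounds. It serves both the pressure
and the growth rate of dynamical nets. -/
lemma limsup_log_div_le_iff (u : ℕ → ENNReal) (a : ℝ) :
    limsup (fun n : ℕ => ENNReal.log (u n) / (n : EReal)) atTop ≤ (a : EReal) ↔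
      ∀ b > a, ∀ᶠ n : ℕ in atTop, u n ≤ ENNReal.ofReal (Real.exp (n * b)) := by
  constructor
  · intro h b hb
    have := eventually_lt_of_limsup_lt (h.trans_lt (EReal.coe_lt_coe_iff.2 hb))
    filter_upwards [this, eventually_gt_atTop 0] with n hn h0
    exact (log_div_le_coe_iff _ h0 b).1 hn.le
  · intro h
    refine le_of_forall_gt_imp_ge_of_dense fun c hc => ?_
    obtain ⟨b, hab, hbc⟩ := EReal.lt_iff_exists_real_btwn.1 hc
    refine le_trans (limsup_le_of_le (h := ?_)) hbc.le
    filter_upwards [h b (EReal.coe_lt_coe_iff.1 hab), eventually_gt_atTop 0] with n hn h0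
    exact (log_div_le_coe_iff _ h0 b).2 hn

/-! ### Pressure: estimates through finite sums, convexity, finiteness -/

section Pressure

variable {X : Type*} [MetricSpace X]

lemma separatedSum_le_ofReal_iff (f : X → X) (ψ : C(X, ℝ)) (ε : ℝ) (n : ℕ) {c : ℝ} (hc : 0 ≤ c) :
    separatedSum f ψ ε n ≤ ENNReal.ofReal c ↔
      ∀ E : Finset X, IsSeparated f n ε E →
        ∑ x ∈ E, Real.exp (birkhoffSum f ψ (n + 1) x) ≤ c := by
  simp only [separatedSum, iSup_le_iff]
  refine forall₂_congr fun E _ => ?_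
  rw [← ENNReal.ofReal_sum_of_nonneg fun _ _ => (Real.exp_pos _).le,
    ENNReal.ofReal_le_ofReal_iff hc]

/-- Upper bounds on the pressure in terms of finite sums over separated sets. -/
lemma topPressure_le_iff (f : X → X) (ψ : C(X, ℝ)) (a : ℝ) :
    topPressure f ψ ≤ (a : EReal) ↔
      ∀ ε > 0, ∀ b > a, ∀ᶠ n : ℕ in atTop, ∀ E : Finset X, IsSeparated f n ε E →
        ∑ x ∈ E, Real.exp (birkhoffSum f ψ (n + 1) x) ≤ Real.exp (n * b) := by
  simp only [topPressure, iSup_le_iff, pressureAt, limsup_log_div_le_iff, gt_iff_lt,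
    separatedSum_le_ofReal_iff f ψ _ _ (Real.exp_pos _).le]

/-- Comparison of the pressures of two potentials through their Birkhoff sums. -/
lemma topPressure_le_add_of_birkhoffSum_le {f : X → X} {ψ₁ ψ₂ : C(X, ℝ)} {c K a : ℝ}
    (h : ∀ (n : ℕ) (x : X),
      birkhoffSum f ψ₁ (n + 1) x ≤ birkhoffSum f ψ₂ (n + 1) x + n * c + K)
    (ha : topPressure f ψ₂ ≤ (a : EReal)) : topPressure f ψ₁ ≤ ((a + c : ℝ) : EReal) := by
  rw [topPressure_le_iff] at ha ⊢
  intro ε hε b hb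
  -- Half of the slack `b - c - a` goes to the growth rate of `ψ₂`, the other half absorbs the
  -- constant `K`.
  have hK : ∀ᶠ n : ℕ in atTop, K ≤ n * ((b - c - a) / 2) :=
    (tendsto_natCast_atTop_atTop.atTop_mul_const (by linarith : 0 < (b - c - a) / 2)).eventually_ge_atTop K
  filter_upwards [ha ε hε (a + (b - c - a) / 2) (by linarith), hK] with n hn hKn E hE
  calc ∑ x ∈ E, Real.exp (birkhoffSum f ψ₁ (n + 1) x)
      ≤ ∑ x ∈ E, Real.exp (birkhoffSum f ψ₂ (n + 1) x) * Real.exp (n * c + K) := by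
        refine Finset.sum_le_sum fun x _ => ?_
        rw [← Real.exp_add]
        exact Real.exp_le_exp.2 (by linarith [h n x])
    _ ≤ Real.exp (n * (a + (b - c - a) / 2)) * Real.exp (n * c + K) := by
        rw [← Finset.sum_mul]
        exact mul_le_mul_of_nonneg_right (hn E hE) (Real.exp_pos _).le
    _ ≤ Real.exp (n * b) := by
        rw [← Real.exp_add]
        exact Real.exp_le_exp.2 (by linarith)

/-- The pressure is a convex function of the potential. -/
lemma topPressure_convex {f : X → X} {ψ₁ ψ₂ : C(X, ℝ)} {a₁ a₂ s t : ℝ} (hs : 0 ≤ s) (ht : 0 ≤ t)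
    (hst : s + t = 1) (h₁ : topPressure f ψ₁ ≤ (a₁ : EReal))
    (h₂ : topPressure f ψ₂ ≤ (a₂ : EReal)) :
    topPressure f (s • ψ₁ + t • ψ₂) ≤ ((s * a₁ + t * a₂ : ℝ) : EReal) := by
  rw [topPressure_le_iff] at h₁ h₂ ⊢
  intro ε hε b hb
  set δ := b - (s * a₁ + t * a₂) with hδ
  have hδ0 : 0 < δ := sub_pos.2 hb
  filter_upwards [h₁ ε hε (a₁ + δ) (by linarith), h₂ ε hε (a₂ + δ) (by linarith)] with n hn₁ hn₂ E hE
  have hb' : b = s * (a₁ + δ) + t * (a₂ + δ) := by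
    linear_combination (-δ) * hst + hδ
  -- Convexity of `exp` replaces Hölder's inequality: once each sum is normalized by its own bound
  -- to be at most 1, the weighted mean is at most s + t = 1.
  have key : ∀ x, Real.exp (birkhoffSum f (s • ψ₁ + t • ψ₂ : C(X, ℝ)) (n + 1) x) ≤
      (s * (Real.exp (birkhoffSum f ψ₁ (n + 1) x) * Real.exp (-(n * (a₁ + δ)))) +
        t * (Real.exp (birkhoffSum f ψ₂ (n + 1) x) * Real.exp (-(n * (a₂ + δ))))) *
          Real.exp (n * b) := by
    intro x
    have hS : birkhoffSum f (s • ψ₁ + t • ψ₂ : C(X, ℝ)) (n + 1) x =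
        s * birkhoffSum f ψ₁ (n + 1) x + t * birkhoffSum f ψ₂ (n + 1) x := by
      simp [birkhoffSum, Finset.sum_add_distrib, Finset.mul_sum]
    have hc := convexOn_exp.2 (Set.mem_univ (birkhoffSum f ψ₁ (n + 1) x + -(n * (a₁ + δ))))
      (Set.mem_univ (birkhoffSum f ψ₂ (n + 1) x + -(n * (a₂ + δ)))) hs ht hst
    simp only [smul_eq_mul] at hc
    rw [← Real.exp_add, ← Real.exp_add]
    refine le_trans (le_of_eq ?_) (mul_le_mul_of_nonneg_right hc (Real.exp_pos _).le)
    rw [← Real.exp_add, hS, hb']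
    congr 1
    ring
  refine (Finset.sum_le_sum fun x _ => key x).trans ?_
  rw [← Finset.sum_mul, Finset.sum_add_distrib, ← Finset.mul_sum, ← Finset.mul_sum,
    ← Finset.sum_mul, ← Finset.sum_mul]
  have e : ∀ c S : ℝ, S ≤ Real.exp c → S * Real.exp (-c) ≤ 1 := fun c S h => by
    rw [Real.exp_neg, ← div_eq_mul_inv]; exact (div_le_one (Real.exp_pos _)).2 h
  have e₁ := mul_le_mul_of_nonneg_left (e _ _ (hn₁ E hE)) hs
  have e₂ := mul_le_mul_of_nonneg_left (e _ _ (hn₂ E hE)) ht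
  calc _ ≤ 1 * Real.exp (n * b) :=
        mul_le_mul_of_nonneg_right (by linarith) (Real.exp_pos _).le
    _ = _ := one_mul _

lemma dynDist_lt_iff (f : X → X) (n : ℕ) (ε : ℝ) (x z : X) :
    dynDist f n x z < ε ↔ ∀ i ≤ n, dist (f^[i] x) (f^[i] z) < ε := by
  simp [dynDist, Finset.sup'_lt_iff]

lemma dynDist_comm (f : X → X) (n : ℕ) (x z : X) : dynDist f n x z = dynDist f n z x := by
  simp only [dynDist, dist_comm]

lemma dynDist_self (f : X → X) (n : ℕ) (x : X) : dynDist f n x x = 0 := by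
  simp [dynDist]

/-- Dynamical nets ask for disjoint balls, whence the radius `ε / 2`; times 0, …, n make `n + 1`
steps. -/
lemma IsSeparated.isDynNetIn {f : X → X} {n : ℕ} {ε : ℝ} {E : Finset X}
    (hE : IsSeparated f n ε E) :
    Dynamics.IsDynNetIn f Set.univ {p : X × X | dist p.1 p.2 < ε / 2} (n + 1) (E : Set X) := by
  refine ⟨Set.subset_univ _, fun x hx z hz hxz => Set.disjoint_left.2 fun y hy hy' => ?_⟩
  rw [Dynamics.mem_ball_dynEntourage] at hy hy'
  refine (hE x hx z hz hxz).not_gt ((dynDist_lt_iff _ _ _ _ _).2 fun i hi => ?_)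
  have h₁ : dist (f^[i] x) (f^[i] y) < ε / 2 := hy i (by omega)
  have h₂ : dist (f^[i] z) (f^[i] y) < ε / 2 := hy' i (by omega)
  linarith [dist_triangle_right (f^[i] x) (f^[i] z) (f^[i] y)]

variable [CompactSpace X]

lemma abs_birkhoffSum_le (f : X → X) (ψ : C(X, ℝ)) (n : ℕ) (x : X) :
    |birkhoffSum f ψ n x| ≤ n * ‖ψ‖ := by
  refine (Finset.abs_sum_le_sum_abs _ _).trans ?_
  refine (Finset.sum_le_card_nsmul _ _ ‖ψ‖ fun i _ => ψ.norm_coe_le_norm _).trans ?_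
  simp

/-- A separated set of maximal cardinality spans. -/
lemma exists_isSeparated_spanning {f : X → X} (hf : Continuous f) (n : ℕ) {ε : ℝ} (hε : 0 < ε) :
    ∃ E : Finset X, IsSeparated f n ε E ∧ ∀ x, ∃ y ∈ E, dynDist f n x y < ε := by
  classical
  -- Compactness gives a finite dynamical cover, whose cardinality bounds that of every separated
  -- set. A set of largest cardinality cannot be enlarged, hence spans.
  obtain ⟨N, hN⟩ : ∃ N : ℕ, ∀ E : Finset X, IsSeparated f n ε E → E.card ≤ N := by
    have hfin := Dynamics.coverMincard_finite_of_isCompact_uniformContinuous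
      (isCompact_univ (X := X)) (CompactSpace.uniformContinuous_of_continuous hf)
      (Metric.dist_mem_uniformity (half_pos hε)) (n + 1)
    obtain ⟨N, hN⟩ := ENat.ne_top_iff_exists.1 hfin.ne
    refine ⟨N, fun E hE => ?_⟩
    have := hE.isDynNetIn.card_le_netMaxcard.trans (Dynamics.netMaxcard_le_coverMincard f _ _)
    rw [← hN] at this
    exact_mod_cast this
  have hne : ∃ k, ∃ E : Finset X, IsSeparated f n ε E ∧ E.card = k :=
    ⟨0, ∅, by simp [IsSeparated], rfl⟩
  let S : Set ℕ := {k | ∃ E : Finset X, IsSeparated f n ε E ∧ E.card = k}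
  have hbdd : BddAbove S := ⟨N, by rintro k ⟨E, hE, rfl⟩; exact hN E hE⟩
  obtain ⟨E, hE, hcard⟩ := Nat.sSup_mem (s := S) hne hbdd
  refine ⟨E, hE, fun x => ?_⟩
  by_contra! hx
  have hxE : x ∉ E := fun h => by
    have := hx x h
    rw [dynDist_self] at this
    linarith
  have hsep : IsSeparated f n ε (insert x E) := by
    intro y hy z hz hyz
    rcases Finset.mem_insert.1 hy with h | h <;> rcases Finset.mem_insert.1 hz with h' | h'
    · exact absurd (h.trans h'.symm) hyz
    · rw [h]; exact hx z h'
    · rw [h', dynDist_comm]; exact hx y h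
    · exact hE y h z h' hyz
  have := le_csSup hbdd (show (insert x E).card ∈ S from ⟨_, hsep, rfl⟩)
  rw [Finset.card_insert_of_notMem hxE] at this
  omega

/-- Finite entropy bounds the cardinality of separated sets exponentially, and each weight is at
most exp((n + 1)‖ψ‖). -/
lemma topPressure_lt_top {f : X → X} (hent : Dynamics.coverEntropy f Set.univ < ⊤) (ψ : C(X, ℝ)) :
    topPressure f ψ < ⊤ := by
  obtain ⟨h, hh, -⟩ := EReal.lt_iff_exists_real_btwn.1 hent
  set a := max h 0 with ha
  have ha0 : 0 ≤ a := le_max_right _ _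
  -- The factors 2 come from n + 1 ≤ 2n; for this the rate `a` was taken nonnegative.
  suffices H : topPressure f ψ ≤ ((2 * (a + 1) + 2 * ‖ψ‖ : ℝ) : EReal) from
    H.trans_lt (EReal.coe_lt_top _)
  rw [topPressure_le_iff]
  intro ε hε b hb
  have hgrowth : Dynamics.netEntropyEntourage f Set.univ {p : X × X | dist p.1 p.2 < ε / 2} ≤
      ((a : ℝ) : EReal) :=
    (Dynamics.netEntropyEntourage_le_coverEntropy f Set.univ
      (Metric.dist_mem_uniformity (half_pos hε))).trans
        (hh.le.trans (EReal.coe_le_coe_iff.2 (le_max_left _ _)))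
  have hev := (limsup_log_div_le_iff _ a).1 hgrowth (a + 1) (by linarith)
  filter_upwards [(tendsto_add_atTop_nat 1).eventually hev, eventually_ge_atTop 1] with n hn h1 E hE
  have hcard : (E.card : ℝ) ≤ Real.exp ((n + 1 : ℕ) * (a + 1)) := by
    have h' : ((E.card : ℕ∞) : ENNReal) ≤ ENNReal.ofReal (Real.exp ((n + 1 : ℕ) * (a + 1))) :=
      le_trans (by exact_mod_cast hE.isDynNetIn.card_le_netMaxcard) hn
    have := ENNReal.toReal_mono ENNReal.ofReal_ne_top h'
    rwa [ENNReal.toReal_ofReal (Real.exp_pos _).le, ENat.toENNReal_coe, ENNReal.toReal_natCast]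
      at this
  have hn1 : (1 : ℝ) ≤ n := by exact_mod_cast h1
  calc ∑ x ∈ E, Real.exp (birkhoffSum f ψ (n + 1) x)
      ≤ ∑ _x ∈ E, Real.exp ((n + 1 : ℕ) * ‖ψ‖) := by
        refine Finset.sum_le_sum fun x _ => Real.exp_le_exp.2 ?_
        exact (le_abs_self _).trans (abs_birkhoffSum_le f ψ _ x)
    _ = E.card * Real.exp ((n + 1 : ℕ) * ‖ψ‖) := by simp
    _ ≤ Real.exp ((n + 1 : ℕ) * (a + 1)) * Real.exp ((n + 1 : ℕ) * ‖ψ‖) :=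
        mul_le_mul_of_nonneg_right hcard (Real.exp_pos _).le
    _ ≤ Real.exp (n * b) := by
        rw [← Real.exp_add]
        refine Real.exp_le_exp.2 ?_
        push_cast
        nlinarith [norm_nonneg ψ]

/-- A single point is a separated set, and its weight is at least exp(-(n + 1)‖ψ‖). -/
lemma bot_lt_topPressure [Nonempty X] (f : X → X) (ψ : C(X, ℝ)) : ⊥ < topPressure f ψ := by
  by_contra hbot
  have h : topPressure f ψ ≤ ((-2 * ‖ψ‖ - 2 : ℝ) : EReal) := by
    rw [not_bot_lt_iff.1 hbot]; exact bot_le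
  rw [topPressure_le_iff] at h
  obtain ⟨n, hn, h1⟩ :=
    ((h 1 one_pos (-2 * ‖ψ‖ - 1) (by linarith)).and (eventually_ge_atTop 1)).exists
  have hn1 : (1 : ℝ) ≤ n := by exact_mod_cast h1
  obtain ⟨x⟩ := ‹Nonempty X›
  have := hn {x} (by intro y hy z hz hyz; simp_all)
  rw [Finset.sum_singleton, Real.exp_le_exp] at this
  have h2 := neg_le_of_abs_le (abs_birkhoffSum_le f ψ (n + 1) x)
  push_cast at h2
  nlinarith [norm_nonneg ψ]

end Pressure

/-! ### Subgradients of the pressure -/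

/-- A finite convex function on a real vector space has a subgradient at every point. -/
lemma exists_subgradient {E : Type*} [AddCommGroup E] [Module ℝ E] {p : E → ℝ}
    (hp : ConvexOn ℝ Set.univ p) (x : E) :
    ∃ L : E →ₗ[ℝ] ℝ, ∀ y, p x + L y ≤ p (x + y) := by
  -- The infimum of these quotients is the one-sided directional derivative of `p` at `x`: a
  -- sublinear function, which Hahn-Banach can dominate.
  let q : E → Set.Ioi (0 : ℝ) → ℝ := fun y s => (p (x + (s : ℝ) • y) - p x) / s
  let N : E → ℝ := fun y => ⨅ s, q y s
  have : Nonempty (Set.Ioi (0 : ℝ)) := ⟨⟨1, Set.mem_Ioi.2 one_pos⟩⟩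
  have hbdd : ∀ y, BddBelow (Set.range (q y)) := by
    intro y
    refine ⟨p x - p (x - y), ?_⟩
    rintro _ ⟨⟨s, hs⟩, rfl⟩
    have hs : 0 < s := hs
    have hs1 : (1 + s) ≠ 0 := by positivity
    -- `x` lies between `x + s • y` and `x - y`, so convexity bounds the quotient below
    -- independently of `s`.
    have h := hp.2 (Set.mem_univ (x + s • y)) (Set.mem_univ (x - y))
      (by positivity : 0 ≤ 1 / (1 + s)) (by positivity : 0 ≤ s / (1 + s)) (by field_simp)
    have hx : (1 / (1 + s)) • (x + s • y) + (s / (1 + s)) • (x - y) = x := by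
      match_scalars <;> field_simp <;> ring
    rw [hx, smul_eq_mul, smul_eq_mul] at h
    have h' := mul_le_mul_of_nonneg_left h (by positivity : 0 ≤ 1 + s)
    have h2 : (1 + s) * (1 / (1 + s) * p (x + s • y) + s / (1 + s) * p (x - y)) =
        p (x + s • y) + s * p (x - y) := by field_simp
    change _ ≤ (p (x + s • y) - p x) / s
    rw [le_div_iff₀ hs]
    linarith
  have hom : ∀ c : ℝ, 0 < c → ∀ y, N (c • y) = c * N y := by
    have hle : ∀ c : ℝ, 0 < c → ∀ y, c * N y ≤ N (c • y) := by
      intro c hc y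
      refine le_ciInf fun s => ?_
      have hsc : (0 : ℝ) < s * c := mul_pos s.2 hc
      have hs : (s : ℝ) ≠ 0 := ne_of_gt s.2
      have h := mul_le_mul_of_nonneg_left (ciInf_le (hbdd y) ⟨s * c, hsc⟩) hc.le
      refine h.trans (le_of_eq ?_)
      simp only [q, smul_smul]
      field_simp
    intro c hc y
    refine le_antisymm ?_ (hle c hc y)
    have h := mul_le_mul_of_nonneg_left (hle c⁻¹ (inv_pos.2 hc) (c • y)) hc.le
    rwa [inv_smul_smul₀ hc.ne', mul_inv_cancel_left₀ hc.ne'] at h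
  have add : ∀ y z, N (y + z) ≤ N y + N z := by
    intro y z
    refine le_ciInf_add_ciInf fun s t => ?_
    have hs : (0 : ℝ) < s := s.2
    have ht : (0 : ℝ) < t := t.2
    -- With this step length, `x + r • (y + z)` is a convex combination of `x + s • y` and `x + t •
    -- z`, and the quotients add exactly.
    have hr : (0 : ℝ) < s * t / (s + t) := by positivity
    refine (ciInf_le (hbdd (y + z)) ⟨_, hr⟩).trans ?_
    have h := hp.2 (Set.mem_univ (x + (s : ℝ) • y)) (Set.mem_univ (x + (t : ℝ) • z))
      (by positivity : 0 ≤ (t : ℝ) / (s + t)) (by positivity : 0 ≤ (s : ℝ) / (s + t))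
      (by field_simp; ring)
    have hx : ((t : ℝ) / (s + t)) • (x + (s : ℝ) • y) + ((s : ℝ) / (s + t)) • (x + (t : ℝ) • z) =
        x + ((s : ℝ) * t / (s + t)) • (y + z) := by
      match_scalars <;> field_simp <;> ring
    rw [hx, smul_eq_mul, smul_eq_mul] at h
    simp only [q]
    rw [div_le_iff₀ hr]
    have e : ((p (x + (s : ℝ) • y) - p x) / s + (p (x + (t : ℝ) • z) - p x) / t) *
        (s * t / (s + t)) = t / (s + t) * p (x + (s : ℝ) • y) + s / (s + t) * p (x + (t : ℝ) • z)
          - p x := by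
      field_simp
      ring
    rw [e]
    linarith
  have N0 : N 0 = 0 := by simp [N, q]
  -- Extending from the zero subspace: only the domination by `N` matters.
  obtain ⟨L, -, hL⟩ := exists_extension_of_le_sublinear (⊥ : E →ₗ.[ℝ] ℝ) N hom add (by
    rintro ⟨y, hy⟩
    obtain rfl : y = 0 := (Submodule.mem_bot ℝ).1 hy
    rw [N0]
    exact le_of_eq (map_zero _))
  refine ⟨L, fun y => ?_⟩
  have h := (hL y).trans (ciInf_le (hbdd y) ⟨1, Set.mem_Ioi.2 one_pos⟩)
  simp only [q, one_smul, div_one] at h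
  linarith

/-- A positive normalized functional on `C(X, ℝ)` is the integral against a probability measure. -/
lemma exists_probabilityMeasure_integral_eq {X : Type*} [MetricSpace X] [CompactSpace X]
    [MeasurableSpace X] [BorelSpace X] (L : C(X, ℝ) →ₗ[ℝ] ℝ) (hpos : ∀ g : C(X, ℝ), 0 ≤ g → 0 ≤ L g)
    (h1 : L 1 = 1) :
    ∃ μ : ProbabilityMeasure X, ∀ g : C(X, ℝ), ∫ x, g x ∂(μ : Measure X) = L g := by
  let Λ : CompactlySupportedContinuousMap X ℝ →ₚ[ℝ] ℝ := PositiveLinearMap.mk₀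
    { toFun := fun g => L g.toContinuousMap
      map_add' := fun g h => map_add L g.toContinuousMap h.toContinuousMap
      map_smul' := fun c g => map_smul L c g.toContinuousMap }
    (fun g hg => hpos g.toContinuousMap hg)
  have hΛ : ∀ g : C(X, ℝ), ∫ x, g x ∂(RealRMK.rieszMeasure Λ) = L g := fun g =>
    RealRMK.integral_rieszMeasure Λ (CompactlySupportedContinuousMap.continuousMapEquiv g)
  have hprob : IsProbabilityMeasure (RealRMK.rieszMeasure Λ) := by
    constructor
    have := hΛ 1
    simp only [ContinuousMap.one_apply, integral_const, smul_eq_mul, mul_one, h1, Measure.real,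
      ENNReal.toReal_eq_one_iff] at this
    exact this
  exact ⟨⟨_, hprob⟩, hΛ⟩

lemma mem_invariantMeasures_iff {X : Type*} [MetricSpace X] [CompactSpace X]
    [MeasurableSpace X] [BorelSpace X] {f : X → X} (hf : Continuous f) (μ : ProbabilityMeasure X) :
    μ ∈ invariantMeasures f ↔
      ∀ g : C(X, ℝ), ∫ x, g (f x) ∂(μ : Measure X) = ∫ x, g x ∂(μ : Measure X) := by
  constructor
  · intro h g
    have h : MeasurePreserving f (μ : Measure X) (μ : Measure X) := h
    conv_rhs => rw [← h.map_eq]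
    rw [integral_map hf.measurable.aemeasurable g.continuous.aestronglyMeasurable]
  · intro h
    refine ⟨hf.measurable, ?_⟩
    have := Measure.isProbabilityMeasure_map (μ := (μ : Measure X)) hf.measurable.aemeasurable
    refine ext_of_forall_integral_eq_of_IsFiniteMeasure fun g => ?_
    rw [integral_map hf.measurable.aemeasurable g.continuous.aestronglyMeasurable]
    exact h g.toContinuousMap

/-! ### Existence of equilibrium states -/

section

variable {X : Type*} [MetricSpace X] [CompactSpace X]

lemma coe_toReal_topPressure [Nonempty X] {f : X → X}
    (hent : Dynamics.coverEntropy f Set.univ < ⊤) (ψ : C(X, ℝ)) :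
    ((topPressure f ψ).toReal : EReal) = topPressure f ψ :=
  EReal.coe_toReal (topPressure_lt_top hent ψ).ne (bot_lt_topPressure f ψ).ne'

lemma convexOn_toReal_topPressure [Nonempty X] {f : X → X}
    (hent : Dynamics.coverEntropy f Set.univ < ⊤) :
    ConvexOn ℝ Set.univ fun ψ : C(X, ℝ) => (topPressure f ψ).toReal := by
  refine ⟨convex_univ, fun ψ₁ _ ψ₂ _ s t hs ht hst => ?_⟩
  have h := topPressure_convex hs ht hst (coe_toReal_topPressure hent ψ₁).ge
    (coe_toReal_topPressure hent ψ₂).ge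
  rw [← coe_toReal_topPressure hent] at h
  exact EReal.coe_le_coe_iff.1 h

/-- Every continuous potential has an equilibrium state. -/
theorem exists_isEquilibriumState [Nonempty X] [MeasurableSpace X] [BorelSpace X] {f : X → X}
    (hf : Continuous f) (hent : Dynamics.coverEntropy f Set.univ < ⊤) (ψ : C(X, ℝ)) :
    ∃ μ, IsEquilibriumState f ψ μ := by
  obtain ⟨L, hL⟩ := exists_subgradient (convexOn_toReal_topPressure hent) ψ
  -- The single source of positivity, normalization and invariance: growth of Birkhoff sums controls
  -- the subgradient.
  have key : ∀ (g : C(X, ℝ)) (c K : ℝ),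
      (∀ (n : ℕ) (x : X), birkhoffSum f g (n + 1) x ≤ n * c + K) → L g ≤ c := by
    intro g c K h
    have hle := topPressure_le_add_of_birkhoffSum_le (f := f) (ψ₁ := ψ + g) (ψ₂ := ψ) (c := c)
      (K := K) (fun n x => by
        have hadd : birkhoffSum f (ψ + g : C(X, ℝ)) (n + 1) x =
            birkhoffSum f ψ (n + 1) x + birkhoffSum f g (n + 1) x := by
          simp [birkhoffSum, Finset.sum_add_distrib]
        linarith [h n x]) (coe_toReal_topPressure hent ψ).ge
    rw [← coe_toReal_topPressure hent] at hle
    linarith [EReal.coe_le_coe_iff.1 hle, hL g]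
  have hpos : ∀ g : C(X, ℝ), 0 ≤ g → 0 ≤ L g := by
    intro g hg
    have := key (-g) 0 0 fun n x => by
      simp only [birkhoffSum, ContinuousMap.neg_apply, Finset.sum_neg_distrib, mul_zero, add_zero,
        Left.neg_nonpos_iff]
      exact Finset.sum_nonneg fun i _ => hg _
    rw [map_neg] at this
    linarith
  -- The Birkhoff sum has n + 1 terms; the extra one is the constant `K`.
  have h1 : L 1 = 1 := by
    have h₁ := key 1 1 1 fun n x => by simp [birkhoffSum]
    have h₂ := key (-1) (-1) (-1) fun n x => by simp [birkhoffSum]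
    rw [map_neg] at h₂
    linarith
  obtain ⟨μ, hμ⟩ := exists_probabilityMeasure_integral_eq L hpos h1
  -- Birkhoff sums of a coboundary telescope and stay bounded by 2‖g‖. Applying this to `-g` later
  -- gives equality.
  have hcob : ∀ g : C(X, ℝ), L (g.comp ⟨f, hf⟩) ≤ L g := by
    intro g
    have := key (g.comp ⟨f, hf⟩ - g) 0 (2 * ‖g‖) fun n x => by
      have htel : birkhoffSum f (g.comp ⟨f, hf⟩ - g : C(X, ℝ)) (n + 1) x =
          g (f^[n + 1] x) - g x := by
        simp only [birkhoffSum, ContinuousMap.sub_apply, ContinuousMap.comp_apply,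
          ContinuousMap.coe_mk, ← Function.iterate_succ_apply' f]
        rw [Finset.sum_range_sub fun i => g (f^[i] x)]
        simp
      have ha := (le_abs_self _).trans (g.norm_coe_le_norm (f^[n + 1] x))
      have hb := (neg_le_abs _).trans (g.norm_coe_le_norm x)
      rw [htel]
      linarith
    rw [map_sub] at this
    linarith
  have hinv : μ ∈ invariantMeasures f := by
    rw [mem_invariantMeasures_iff hf]
    intro g
    have e : ∫ x, g (f x) ∂(μ : Measure X) = L (g.comp ⟨f, hf⟩) := hμ (g.comp ⟨f, hf⟩)
    rw [e, hμ]
    refine le_antisymm (hcob g) ?_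
    have := hcob (-g)
    rw [map_neg, show (-g).comp ⟨f, hf⟩ = -(g.comp ⟨f, hf⟩) from rfl, map_neg] at this
    linarith
  refine ⟨μ, hinv, ?_⟩
  -- The subgradient inequality reads P(g) - L g ≥ P(ψ) - L ψ, so the infimum is attained at `ψ`.
  have hvar : varEntropy f μ = (((topPressure f ψ).toReal - L ψ : ℝ) : EReal) := by
    refine le_antisymm ?_ (le_iInf fun g => ?_)
    · refine (iInf_le _ ψ).trans (le_of_eq ?_)
      rw [EReal.coe_sub, coe_toReal_topPressure hent, hμ]
    · rw [← coe_toReal_topPressure hent g, hμ, ← EReal.coe_sub, EReal.coe_le_coe_iff]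
      have := hL (g - ψ)
      rw [map_sub, add_sub_cancel] at this
      linarith
  rw [hvar, hμ, ← EReal.coe_add, sub_add_cancel, coe_toReal_topPressure hent]

end

/-! ### Shannon entropy of finite labellings -/

/-- Itineraries up to time `m` are determined by itineraries for an iterate of the map. -/
lemma exists_itinerary_eq_comp {X α : Type*} (f : X → X) (ξ : X → α) {m n N : ℕ} (hN : 0 < N) (hm : m ≤ n * N) :
    ∃ G : (Fin n → Fin N → α) → (Fin m → α),
      itinerary f ξ m = G ∘ itinerary f^[N] (itinerary f ξ N) n := by
  refine ⟨fun w i => w ⟨i / N, (Nat.div_lt_iff_lt_mul hN).2 (i.2.trans_le hm)⟩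
    ⟨i % N, Nat.mod_lt _ hN⟩, ?_⟩
  funext x i
  simp only [itinerary, Function.comp_apply]
  rw [← Function.iterate_mul, ← Function.iterate_add_apply, Nat.mod_add_div]

section Entropy

variable {X : Type*} [MeasurableSpace X] {α β : Type*}

lemma sum_real_preimage_eq_one (μ : ProbabilityMeasure X) {W : X → α}
    (hW : ∀ a, MeasurableSet (W ⁻¹' {a})) {T : Finset α} (hT : ∀ x, W x ∈ T) :
    ∑ a ∈ T, (μ : Measure X).real (W ⁻¹' {a}) = 1 := by
  rw [sum_measureReal_preimage_singleton T fun a _ => hW a,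
    show W ⁻¹' (T : Set α) = Set.univ from Set.eq_univ_of_forall hT]
  simp

lemma partitionEntropy_nonneg [Fintype α] (μ : ProbabilityMeasure X) (W : X → α) :
    0 ≤ partitionEntropy μ W :=
  Finset.sum_nonneg fun _ _ => Real.negMulLog_nonneg measureReal_nonneg measureReal_le_one

/-- The entropy decreases when the partition is made coarser. -/
lemma partitionEntropy_comp_le [Fintype α] [Fintype β] (μ : ProbabilityMeasure X) {W : X → α}
    (hW : ∀ a, MeasurableSet (W ⁻¹' {a})) (g : α → β) :
    partitionEntropy μ (g ∘ W) ≤ partitionEntropy μ W := by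
  classical
  rw [partitionEntropy, partitionEntropy,
    ← Finset.sum_fiberwise_of_maps_to (t := Finset.univ) (g := g) fun _ _ => Finset.mem_univ _]
  refine Finset.sum_le_sum fun b _ => ?_
  have hpre : (μ : Measure X).real (g ∘ W ⁻¹' {b}) =
      ∑ a with g a = b, (μ : Measure X).real (W ⁻¹' {a}) := by
    rw [sum_measureReal_preimage_singleton _ fun a _ => hW a]
    congr 1
    ext x
    simp
  rw [hpre]
  set s : Finset α := {a | g a = b}
  set p : α → ℝ := fun a => (μ : Measure X).real (W ⁻¹' {a})
  have hp : ∀ a, 0 ≤ p a := fun a => measureReal_nonneg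
  rw [Real.negMulLog, neg_mul, Finset.sum_mul, ← Finset.sum_neg_distrib]
  -- Term by term: a cell has at most the mass of the class containing it, so -log of the class mass
  -- is the smaller.
  refine Finset.sum_le_sum fun a ha => ?_
  rw [Real.negMulLog, neg_mul, neg_le_neg_iff]
  rcases (hp a).eq_or_lt with h | h
  · change p a * _ ≤ p a * _
    rw [← h]; simp
  · exact mul_le_mul_of_nonneg_left
      (Real.log_le_log h (Finset.single_le_sum (fun a _ => hp a) ha)) h.le

/-- The Gibbs inequality for a labelling `W` with values in `T`. -/
lemma partitionEntropy_add_integral_le [Fintype α] (μ : ProbabilityMeasure X) {W : X → α}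
    (hW : ∀ a, MeasurableSet (W ⁻¹' {a})) {T : Finset α} (hT : ∀ x, W x ∈ T) (c : α → ℝ)
    {F : X → ℝ} (hF : Integrable F (μ : Measure X)) (hFc : ∀ x, F x ≤ c (W x)) :
    partitionEntropy μ W + ∫ x, F x ∂(μ : Measure X) ≤ Real.log (∑ a ∈ T, Real.exp (c a)) := by
  classical
  set p : α → ℝ := fun a => (μ : Measure X).real (W ⁻¹' {a}) with hp
  have hpn : ∀ a, 0 ≤ p a := fun a => measureReal_nonneg
  have hsum1 : ∑ a ∈ T, p a = 1 := sum_real_preimage_eq_one μ hW hT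
  have hp0 : ∀ a ∉ T, p a = 0 := by
    intro a ha
    have : W ⁻¹' {a} = ∅ := by
      ext x
      simp only [Set.mem_preimage, Set.mem_singleton_iff, Set.mem_empty_iff_false, iff_false]
      rintro rfl
      exact ha (hT x)
    simp [p, this]
  have hH : partitionEntropy μ W = ∑ a ∈ T, Real.negMulLog (p a) :=
    (Finset.sum_subset (Finset.subset_univ T) fun a _ ha => by
      change Real.negMulLog (p a) = 0
      rw [hp0 a ha]; simp).symm
  have hcW : (fun x => c (W x)) = fun x => ∑ a ∈ T, (W ⁻¹' {a}).indicator (fun _ => c a) x := by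
    funext x
    rw [Finset.sum_eq_single (W x)]
    · simp
    · intro a _ ha
      exact Set.indicator_of_notMem (fun h => ha h.symm) _
    · exact fun h => absurd (hT x) h
  have hint : ∀ a ∈ T, Integrable ((W ⁻¹' {a}).indicator fun _ => c a) (μ : Measure X) :=
    fun a _ => (integrable_const (c a)).indicator (hW a)
  have hI : ∫ x, F x ∂(μ : Measure X) ≤ ∑ a ∈ T, p a * c a := by
    have h1 : ∫ x, c (W x) ∂(μ : Measure X) = ∑ a ∈ T, p a * c a := by
      rw [hcW, integral_finsetSum _ hint]
      refine Finset.sum_congr rfl fun a _ => ?_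
      rw [integral_indicator_const _ (hW a), smul_eq_mul]
    rw [← h1]
    refine integral_mono hF ?_ hFc
    rw [hcW]
    exact integrable_finsetSum _ hint
  have hTne : T.Nonempty := by
    by_contra h
    rw [Finset.not_nonempty_iff_eq_empty.1 h] at hsum1
    simp at hsum1
  set Z := ∑ a ∈ T, Real.exp (c a)
  have hZ : 0 < Z := Finset.sum_pos (fun a _ => Real.exp_pos _) hTne
  -- This is log u ≤ u - 1 at u = (exp(c a) / Z) / p a, multiplied by `p a`; both terms on the right
  -- sum to 1 over `T`.
  have key : ∀ a, Real.negMulLog (p a) + p a * c a - p a * Real.log Z ≤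
      Real.exp (c a) / Z - p a := by
    intro a
    rcases (hpn a).eq_or_lt with h | h
    · rw [← h]
      simp only [Real.negMulLog_zero, zero_mul, add_zero, sub_zero]
      positivity
    · have hl := Real.log_le_sub_one_of_pos (div_pos (div_pos (Real.exp_pos (c a)) hZ) h)
      rw [Real.log_div (by positivity) h.ne', Real.log_div (Real.exp_pos _).ne' hZ.ne',
        Real.log_exp] at hl
      have hm := mul_le_mul_of_nonneg_left hl h.le
      rw [mul_sub _ (_ / _), mul_one, mul_div_cancel₀ _ h.ne'] at hm
      rw [Real.negMulLog]
      linarith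
  have hs := Finset.sum_le_sum fun a (_ : a ∈ T) => key a
  rw [Finset.sum_sub_distrib, Finset.sum_sub_distrib, Finset.sum_add_distrib, ← Finset.sum_mul,
    ← Finset.sum_div, hsum1, div_self hZ.ne'] at hs
  rw [hH]
  linarith

lemma measurableSet_itinerary_preimage {f : X → X} (hf : Measurable f) {ξ : X → α}
    (hξ : ∀ a, MeasurableSet (ξ ⁻¹' {a})) (n : ℕ) (w : Fin n → α) :
    MeasurableSet (itinerary f ξ n ⁻¹' {w}) := by
  have : itinerary f ξ n ⁻¹' {w} = ⋂ i : Fin n, f^[i] ⁻¹' (ξ ⁻¹' {w i}) := by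
    ext x
    simp [itinerary, funext_iff]
  rw [this]
  exact MeasurableSet.iInter fun i => (hf.iterate i) (hξ _)

/-- A weighted count of words over an alphabet of labels, each flagged as good or bad, such that
only one good label is allowed at each place. -/
lemma sum_exp_neg_cost_le {K : Type*} [Fintype K] [Nonempty K] {n : ℕ}
    (A : Fin n → Finset (K × Bool))
    (hA : ∀ i c c', (c, true) ∈ A i → (c', true) ∈ A i → c = c') :
    ∑ w ∈ Fintype.piFinset A,
      Real.exp (-∑ i, if (w i).2 then 0 else Real.log (Fintype.card K)) ≤ 2 ^ n := by
  classical
  have hK : (0 : ℝ) < Fintype.card K := by exact_mod_cast Fintype.card_pos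
  set wt : K × Bool → ℝ := fun l => if l.2 then 1 else (Fintype.card K : ℝ)⁻¹ with hwt
  have hwt0 : ∀ l, 0 ≤ wt l := fun l => by simp only [wt]; split_ifs <;> positivity
  have hexp : ∀ w : Fin n → K × Bool,
      Real.exp (-∑ i, if (w i).2 then 0 else Real.log (Fintype.card K)) = ∏ i, wt (w i) := by
    intro w
    rw [← Finset.sum_neg_distrib, Real.exp_sum]
    refine Finset.prod_congr rfl fun i _ => ?_
    simp only [wt]
    split_ifs
    · simp
    · rw [Real.exp_neg, Real.exp_log hK]
  simp only [hexp]
  -- The weighted count factors over places. Each factor is at most 2: at most one good label of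
  -- weight 1, and at most |K| bad labels of weight 1/|K|.
  rw [← Finset.prod_univ_sum]
  refine (Finset.prod_le_prod (g := fun _ => (2 : ℝ))
    (fun i _ => Finset.sum_nonneg fun l _ => hwt0 l) fun i _ => ?_).trans (by simp)
  rw [← Finset.sum_filter_add_sum_filter_not (A i) (fun l => l.2 = true)]
  have hgood : ∑ l ∈ A i with l.2 = true, wt l ≤ 1 := by
    have hc : ((A i).filter fun l => l.2 = true).card ≤ 1 := by
      rw [Finset.card_le_one]
      rintro ⟨c, b⟩ h ⟨c', b'⟩ h'
      rw [Finset.mem_filter] at h h'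
      obtain ⟨h, rfl : b = true⟩ := h
      obtain ⟨h', rfl : b' = true⟩ := h'
      rw [hA i c c' h h']
    calc ∑ l ∈ A i with l.2 = true, wt l = ∑ l ∈ A i with l.2 = true, 1 :=
          Finset.sum_congr rfl fun l hl => by simp [wt, (Finset.mem_filter.1 hl).2]
      _ ≤ 1 := by
          rw [Finset.sum_const, nsmul_eq_mul, mul_one]
          exact_mod_cast hc
  have hbad : ∑ l ∈ A i with ¬l.2 = true, wt l ≤ 1 := by
    calc ∑ l ∈ A i with ¬l.2 = true, wt l
        ≤ ∑ l ∈ Finset.univ.image fun c : K => (c, false), wt l := by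
          refine Finset.sum_le_sum_of_subset_of_nonneg ?_ fun l _ _ => hwt0 l
          rintro ⟨c, b⟩ h
          rw [Finset.mem_filter] at h
          simp_all
      _ = 1 := by
          rw [Finset.sum_image fun c _ c' _ h => (Prod.ext_iff.1 h).1]
          simp [wt, hK.ne']
  linarith

end Entropy

/-! ### The entropy of an invariant measure is bounded by the pressure -/

lemma metricEntropy_nonneg {X : Type*} [MeasurableSpace X] (f : X → X) (μ : ProbabilityMeasure X) :
    0 ≤ metricEntropy f μ := by
  refine le_iSup₂_of_le 1 (fun _ => 0) (le_iSup_of_le measurable_const ?_)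
  refine le_limsup_of_frequently_le (Eventually.frequently (Eventually.of_forall fun n => ?_))
  exact EReal.coe_nonneg.2 (div_nonneg (partitionEntropy_nonneg μ _) (Nat.cast_nonneg n))

section Ruelle

variable {X : Type*} [MetricSpace X] [CompactSpace X] [MeasurableSpace X] [BorelSpace X]

lemma invariantMeasures.integral_birkhoffSum {f : X → X} {μ : ProbabilityMeasure X}
    (hμ : μ ∈ invariantMeasures f) (hf : Continuous f) (ψ : C(X, ℝ)) (n : ℕ) :
    Integrable (birkhoffSum f ψ n) (μ : Measure X) ∧
      ∫ x, birkhoffSum f ψ n x ∂(μ : Measure X) = n * ∫ x, ψ x ∂(μ : Measure X) := by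
  have hi : ∀ i, Integrable (fun x => ψ (f^[i] x)) (μ : Measure X) := fun i =>
    (ψ.comp ⟨f^[i], hf.iterate i⟩).continuous.integrable_of_hasCompactSupport
      (HasCompactSupport.of_compactSpace _)
  have hI : ∀ i, ∫ x, ψ (f^[i] x) ∂(μ : Measure X) = ∫ x, ψ x ∂(μ : Measure X) := by
    intro i
    have h : MeasurePreserving f^[i] (μ : Measure X) (μ : Measure X) :=
      MeasurePreserving.iterate hμ i
    conv_rhs => rw [← h.map_eq]
    rw [integral_map h.measurable.aemeasurable ψ.continuous.aestronglyMeasurable]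
  refine ⟨integrable_finsetSum _ fun i _ => hi i, ?_⟩
  simp only [birkhoffSum]
  rw [integral_finsetSum _ fun i _ => hi i]
  simp [hI]

/-- A finite measurable partition agrees, off a set of small measure, with a labelling that is
locally constant at a uniform scale. -/
lemma exists_good_set (μ : ProbabilityMeasure X) {K : Type*} [Fintype K] {ζ : X → K}
    (hζ : ∀ c, MeasurableSet (ζ ⁻¹' {c})) {η : ℝ} (hη : 0 < η) :
    ∃ B : Set X, MeasurableSet B ∧ (μ : Measure X).real Bᶜ ≤ η ∧
      ∃ ε > 0, ∀ z ∈ B, ∀ z' ∈ B, dist z z' < ε → ζ z = ζ z' := by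
  classical
  have hη' : (0 : ℝ) < η / (Fintype.card K + 1) := by positivity
  -- Inner approximation of each cell by a closed set; being compact and disjoint, these sets lie at
  -- positive distance from each other.
  choose D hDsub hDclosed hDμ using fun c =>
    (hζ c).exists_isClosed_sdiff_lt (measure_ne_top (μ : Measure X) _)
      (ENNReal.ofReal_pos.2 hη').ne'
  refine ⟨⋃ c, D c, MeasurableSet.iUnion fun c => (hDclosed c).measurableSet, ?_, ?_⟩
  · have hsub : (⋃ c, D c)ᶜ ⊆ ⋃ c, (ζ ⁻¹' {c} \ D c) := by
      intro x hx
      simp only [Set.mem_compl_iff, Set.mem_iUnion, not_exists] at hx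
      exact Set.mem_iUnion.2 ⟨ζ x, rfl, hx _⟩
    calc (μ : Measure X).real (⋃ c, D c)ᶜ
        ≤ (μ : Measure X).real (⋃ c, (ζ ⁻¹' {c} \ D c)) := measureReal_mono hsub
      _ ≤ ∑ c, (μ : Measure X).real (ζ ⁻¹' {c} \ D c) := measureReal_iUnion_fintype_le _
      _ ≤ ∑ _c : K, η / (Fintype.card K + 1) := Finset.sum_le_sum fun c _ =>
          ENNReal.toReal_le_of_le_ofReal hη'.le (hDμ c).le
      _ ≤ η := by
          rw [Finset.sum_const, Finset.card_univ, nsmul_eq_mul, mul_div_assoc', div_le_iff₀ (by positivity)]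
          nlinarith
  · have hpair : ∀ c c' : K, c ≠ c' →
        ∀ᶠ ε : ℝ in 𝓝[>] 0, ∀ z ∈ D c, ∀ z' ∈ D c', ε ≤ dist z z' := by
      intro c c' hcc'
      have hdisj : Disjoint (D c) (D c') := Set.disjoint_left.2 fun x hx hx' =>
        hcc' ((hDsub c hx).symm.trans (hDsub c' hx'))
      obtain ⟨r, hr, h⟩ := Metric.exists_pos_forall_lt_edist (hDclosed c).isCompact (hDclosed c')
        hdisj
      filter_upwards [Ioo_mem_nhdsGT (NNReal.coe_pos.2 hr)] with ε hε z hz z' hz'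
      have := h z hz z' hz'
      rw [edist_nndist, ENNReal.coe_lt_coe] at this
      exact (hε.2.trans (NNReal.coe_lt_coe.2 this)).le
    have hall : ∀ᶠ ε : ℝ in 𝓝[>] 0, ∀ c c' : K, c ≠ c' →
        ∀ z ∈ D c, ∀ z' ∈ D c', ε ≤ dist z z' := by
      simp only [eventually_all]
      exact hpair
    obtain ⟨ε, h, hε⟩ := (hall.and self_mem_nhdsWithin).exists
    refine ⟨ε, hε, fun z hz z' hz' hzz' => ?_⟩
    obtain ⟨c, hc⟩ := Set.mem_iUnion.1 hz
    obtain ⟨c', hc'⟩ := Set.mem_iUnion.1 hz'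
    by_contra hne
    refine (h c c' ?_ z hc z' hc').not_gt hzz'
    rintro rfl
    exact hne ((hDsub c hc).trans (hDsub c hc').symm)

/-- Counting estimate at a fixed scale: itineraries of an iterate `f^[N]` against a separated
set for `f`. -/
lemma partitionEntropy_itinerary_le {f : X → X} (hf : Continuous f) {μ : ProbabilityMeasure X}
    (hμ : μ ∈ invariantMeasures f) (ψ : C(X, ℝ)) {K : Type*} [Fintype K] [Nonempty K] {ζ : X → K}
    (hζ : ∀ c, MeasurableSet (ζ ⁻¹' {c})) {B : Set X} (hB : MeasurableSet B) {ε δ C : ℝ}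
    (hε : 0 < ε) (hsep : ∀ z ∈ B, ∀ z' ∈ B, dist z z' < 2 * ε → ζ z = ζ z')
    (hδ : ∀ z z', dist z z' < ε → ψ z ≤ ψ z' + δ) (n N : ℕ)
    (hC : ∀ E : Finset X, IsSeparated f (n * N) ε E →
      ∑ x ∈ E, Real.exp (birkhoffSum f ψ (n * N + 1) x) ≤ Real.exp C) :
    partitionEntropy μ (itinerary f^[N] ζ n) + (n * N + 1) * ∫ x, ψ x ∂(μ : Measure X) ≤
      C + n * (Real.log 2 + Real.log (Fintype.card K) * (μ : Measure X).real Bᶜ) + 1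
        + (n * N + 1) * δ := by
  classical
  have hX : Nonempty X := (μ : Measure X).nonempty_of_neZero
  set M := n * N with hM
  set S : X → ℝ := birkhoffSum f ψ (M + 1) with hS
  set κ := Real.log (Fintype.card K) with hκ
  -- Remembering whether each visit is in `B` makes the penalty a function of the word.
  set lab : X → K × Bool := fun x => (ζ x, decide (x ∈ B)) with hlab
  have hlabm : ∀ a, MeasurableSet (lab ⁻¹' {a}) := by
    rintro ⟨c, b⟩
    have : lab ⁻¹' {(c, b)} = ζ ⁻¹' {c} ∩ {x | decide (x ∈ B) = b} := by
      ext x; simp [lab, Prod.ext_iff]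
    rw [this]
    refine (hζ c).inter ?_
    cases b
    · convert hB.compl using 1
      ext x; simp
    · convert hB using 1
      ext x; simp
  set W : X → Fin n → K × Bool := itinerary f^[N] lab n with hW
  have hfN : Continuous f^[N] := hf.iterate N
  have hWm := measurableSet_itinerary_preimage hfN.measurable hlabm n
  have hcoarse : partitionEntropy μ (itinerary f^[N] ζ n) ≤ partitionEntropy μ W :=
    partitionEntropy_comp_le μ hWm fun w i => (w i).1
  set cost : (Fin n → K × Bool) → ℝ := fun w => ∑ i, if (w i).2 then 0 else κ with hcost
  set a : (Fin n → K × Bool) → ℝ := fun w => sSup (S '' (W ⁻¹' {w})) with ha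
  have hbdd : ∀ w, BddAbove (S '' (W ⁻¹' {w})) := by
    intro w
    refine ⟨(M + 1 : ℕ) * ‖ψ‖, ?_⟩
    rintro _ ⟨x, -, rfl⟩
    exact (le_abs_self _).trans (abs_birkhoffSum_le f ψ _ x)
  have hSa : ∀ x, S x ≤ a (W x) := fun x => le_csSup (hbdd _) ⟨x, rfl, rfl⟩
  set T : Finset (Fin n → K × Bool) := {w | ∃ x, W x = w} with hT
  have hWT : ∀ x, W x ∈ T := fun x => by simp [T]
  -- the penalty for bad places
  set pen : X → ℝ := fun x => ∑ i : Fin n, Bᶜ.indicator (fun _ => κ) ((f^[N])^[i] x) with hpen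
  have hpenW : ∀ x, cost (W x) = pen x := by
    intro x
    refine Finset.sum_congr rfl fun i _ => ?_
    by_cases h : (f^[N])^[i] x ∈ B <;> simp [W, itinerary, lab, h]
  have hpi : ∀ i : Fin n, Integrable (fun x => Bᶜ.indicator (fun _ => κ) ((f^[N])^[i] x))
      (μ : Measure X) ∧ ∫ x, Bᶜ.indicator (fun _ => κ) ((f^[N])^[i] x) ∂(μ : Measure X) =
        κ * (μ : Measure X).real Bᶜ := by
    intro i
    have hμf : MeasurePreserving f (μ : Measure X) (μ : Measure X) := hμ
    have h : MeasurePreserving (f^[N])^[i] (μ : Measure X) (μ : Measure X) :=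
      (hμf.iterate N).iterate i
    have hint : Integrable (Bᶜ.indicator fun _ => κ) (μ : Measure X) :=
      (integrable_const κ).indicator hB.compl
    refine ⟨h.integrable_comp_of_integrable hint, ?_⟩
    have := integral_map h.measurable.aemeasurable
      (f := Bᶜ.indicator fun _ => κ) (by rw [h.map_eq]; exact hint.aestronglyMeasurable)
    rw [← this, h.map_eq, integral_indicator_const _ hB.compl, smul_eq_mul, mul_comm]
  have hpenI : Integrable pen (μ : Measure X) ∧
      ∫ x, pen x ∂(μ : Measure X) = n * (κ * (μ : Measure X).real Bᶜ) := by
    refine ⟨integrable_finsetSum _ fun i _ => (hpi i).1, ?_⟩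
    simp only [pen]
    rw [integral_finsetSum _ fun i _ => (hpi i).1]
    simp [fun i => (hpi i).2]
  obtain ⟨hSi, hSI⟩ := invariantMeasures.integral_birkhoffSum hμ hf ψ (M + 1)
  -- Charging log |K| per bad visit offsets the free choice of label there; by invariance its mean
  -- is only nκ μ(Bᶜ).
  have hgibbs := partitionEntropy_add_integral_le μ hWm hWT (fun w => a w - cost w)
    (F := fun x => S x - pen x) (hSi.sub hpenI.1) fun x => by
      have := hSa x
      rw [hpenW]
      linarith
  rw [integral_sub hSi hpenI.1, hSI, hpenI.2] at hgibbs
  -- choice of points of a spanning separated set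
  obtain ⟨E, hE, hspan⟩ := exists_isSeparated_spanning hf M hε
  have hchoice : ∀ w ∈ T, ∃ y ∈ E, (∃ x, W x = w ∧ dynDist f M x y < ε) ∧
      a w ≤ S y + (M + 1) * δ + 1 := by
    intro w hw
    obtain ⟨x₀, hx₀⟩ := (Finset.mem_filter.1 hw).2
    -- The supremum need not be attained; settling for one less costs the additive 1 of the
    -- estimate.
    obtain ⟨_, ⟨x, hx, rfl⟩, hlt⟩ := exists_lt_of_lt_csSup
      (⟨S x₀, x₀, hx₀, rfl⟩ : (S '' (W ⁻¹' {w})).Nonempty) (sub_one_lt (a w))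
    obtain ⟨y, hy, hxy⟩ := hspan x
    refine ⟨y, hy, ⟨x, hx, hxy⟩, ?_⟩
    have hSxy : S x ≤ S y + (M + 1) * δ := by
      have : S x ≤ ∑ i ∈ Finset.range (M + 1), (ψ (f^[i] y) + δ) :=
        Finset.sum_le_sum fun i hi => hδ _ _
          ((dynDist_lt_iff _ _ _ _ _).1 hxy i (Finset.mem_range_succ_iff.1 hi))
      rw [Finset.sum_add_distrib] at this
      simpa [S, birkhoffSum] using this
    linarith
  choose! Y hYE hYx hYa using hchoice
  have hfib : ∀ y ∈ E, ∑ w ∈ T with Y w = y, Real.exp (-cost w) ≤ 2 ^ n := by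
    intro y _
    -- Words assigned to `y` only use labels visible within `ε` of the orbit of `y`. Two good points
    -- there are less than 2ε apart, so they share a label.
    set A : Fin n → Finset (K × Bool) := fun i =>
      {l | ∃ z, dist z ((f^[N])^[i] y) < ε ∧ lab z = l} with hA
    have hAA : ∀ i c c', (c, true) ∈ A i → (c', true) ∈ A i → c = c' := by
      intro i c c' h h'
      obtain ⟨z, hz, hzl⟩ := (Finset.mem_filter.1 h).2
      obtain ⟨z', hz', hzl'⟩ := (Finset.mem_filter.1 h').2
      obtain ⟨rfl, hzB⟩ := Prod.ext_iff.1 hzl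
      obtain ⟨rfl, hzB'⟩ := Prod.ext_iff.1 hzl'
      exact hsep z (of_decide_eq_true hzB) z' (of_decide_eq_true hzB')
        (by linarith [dist_triangle_right z z' ((f^[N])^[i] y)])
    refine le_trans (Finset.sum_le_sum_of_subset_of_nonneg ?_ fun _ _ _ => (Real.exp_pos _).le)
      (sum_exp_neg_cost_le A hAA)
    intro w hw
    obtain ⟨hwT, rfl⟩ := Finset.mem_filter.1 hw
    obtain ⟨x, rfl, hx⟩ := hYx w hwT
    refine Fintype.mem_piFinset.2 fun i => Finset.mem_filter.2 ⟨Finset.mem_univ _, _, ?_, rfl⟩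
    have := (dynDist_lt_iff _ _ _ _ _).1 hx (N * i)
      (by rw [hM, mul_comm]; exact Nat.mul_le_mul_right _ i.2.le)
    rwa [Function.iterate_mul] at this
  have hcount : ∑ w ∈ T, Real.exp (a w - cost w) ≤
      Real.exp (C + n * Real.log 2 + (M + 1) * δ + 1) := by
    calc ∑ w ∈ T, Real.exp (a w - cost w)
        ≤ ∑ w ∈ T, Real.exp (S (Y w)) * Real.exp ((M + 1) * δ + 1) * Real.exp (-cost w) := by
          refine Finset.sum_le_sum fun w hw => ?_
          rw [← Real.exp_add, ← Real.exp_add]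
          exact Real.exp_le_exp.2 (by linarith [hYa w hw])
      _ = ∑ y ∈ E, ∑ w ∈ T with Y w = y,
            Real.exp (S (Y w)) * Real.exp ((M + 1) * δ + 1) * Real.exp (-cost w) :=
          (Finset.sum_fiberwise_of_maps_to hYE _).symm
      _ = ∑ y ∈ E, Real.exp (S y) * Real.exp ((M + 1) * δ + 1) *
            ∑ w ∈ T with Y w = y, Real.exp (-cost w) := by
          refine Finset.sum_congr rfl fun y _ => ?_
          rw [Finset.mul_sum]
          refine Finset.sum_congr rfl fun w hw => ?_
          rw [(Finset.mem_filter.1 hw).2]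
      _ ≤ ∑ y ∈ E, Real.exp (S y) * Real.exp ((M + 1) * δ + 1) * 2 ^ n :=
          Finset.sum_le_sum fun y hy => mul_le_mul_of_nonneg_left (hfib y hy) (by positivity)
      _ = (∑ y ∈ E, Real.exp (S y)) * Real.exp ((M + 1) * δ + 1) * 2 ^ n := by
          rw [Finset.sum_mul, Finset.sum_mul]
      _ ≤ Real.exp C * Real.exp ((M + 1) * δ + 1) * 2 ^ n := by
          gcongr
          exact hC E hE
      _ = Real.exp (C + n * Real.log 2 + (M + 1) * δ + 1) := by
          rw [← Real.exp_log (show (0 : ℝ) < 2 ^ n by positivity), Real.log_pow, ← Real.exp_add,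
            ← Real.exp_add]
          congr 1
          ring
  have hpos : 0 < ∑ w ∈ T, Real.exp (a w - cost w) := by
    obtain ⟨x⟩ := hX
    exact Finset.sum_pos (fun _ _ => Real.exp_pos _) ⟨_, hWT x⟩
  have hlog := Real.log_le_log hpos hcount
  rw [Real.log_exp] at hlog
  have hMc : (M : ℝ) = n * N := by rw [hM]; push_cast; ring
  push_cast at hgibbs
  rw [hMc] at hgibbs hlog
  linarith

/-- The variational inequality for a single partition, up to an error from one time step of an
iterate of the map. -/
lemma entropyOfPartition_le {f : X → X} (hf : Continuous f) {μ : ProbabilityMeasure X}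
    (hμ : μ ∈ invariantMeasures f) (ψ : C(X, ℝ)) {k : ℕ} {ξ : X → Fin k} (hξ : Measurable ξ)
    {P : ℝ} (hP : topPressure f ψ ≤ (P : EReal)) {N : ℕ} (hN : 0 < N) {δ : ℝ} (hδ : 0 < δ) :
    entropyOfPartition f μ ξ ≤
      ((P + 2 * δ - ∫ x, ψ x ∂(μ : Measure X) + (Real.log 2 + 1) / N + δ : ℝ) : EReal) := by
  obtain ⟨x₀⟩ : Nonempty X := (μ : Measure X).nonempty_of_neZero
  have : Nonempty (Fin N → Fin k) := ⟨fun _ => ξ x₀⟩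
  set I := ∫ x, ψ x ∂(μ : Measure X) with hI
  set ζ : X → Fin N → Fin k := itinerary f ξ N with hζdef
  have hξ' : ∀ a, MeasurableSet (ξ ⁻¹' {a}) := fun a => hξ (measurableSet_singleton a)
  have hζ := measurableSet_itinerary_preimage hf.measurable hξ' N
  set κ := Real.log (Fintype.card (Fin N → Fin k)) with hκ
  have hκ0 : 0 ≤ κ := Real.log_natCast_nonneg _
  -- This mass makes the bad-visit cost at most 1 per block, although `κ` grows with `N`.
  obtain ⟨B, hB, hBμ, ε₁, hε₁, hsep⟩ := exists_good_set μ hζ (η := 1 / (κ + 1)) (by positivity)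
  have hbad : κ * (μ : Measure X).real Bᶜ ≤ 1 := by
    calc κ * (μ : Measure X).real Bᶜ ≤ κ * (1 / (κ + 1)) := mul_le_mul_of_nonneg_left hBμ hκ0
      _ ≤ 1 := by rw [mul_one_div, div_le_one (by positivity)]; linarith
  obtain ⟨ε₂, hε₂, hunif⟩ := Metric.uniformContinuous_iff.1
    (CompactSpace.uniformContinuous_of_continuous ψ.continuous) δ hδ
  set ε := min (ε₁ / 2) ε₂ with hε
  have hε0 : 0 < ε := lt_min (half_pos hε₁) hε₂
  have hψ : ∀ z z', dist z z' < ε → ψ z ≤ ψ z' + δ := fun z z' h => by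
    have := hunif (h.trans_le (min_le_right _ _))
    rw [Real.dist_eq] at this
    linarith [(abs_lt.1 this).2]
  have hsep' : ∀ z ∈ B, ∀ z' ∈ B, dist z z' < 2 * ε → ζ z = ζ z' := fun z hz z' hz' h =>
    hsep z hz z' hz' (h.trans_le (by linarith [min_le_left (ε₁ / 2) ε₂]))
  -- the linear bound along multiples of `N`
  set A := N * (P + δ + δ - I) + Real.log 2 + 1 with hA
  set D := 1 + δ - I with hD
  have hlin : ∀ᶠ n : ℕ in atTop, partitionEntropy μ (itinerary f^[N] ζ n) ≤ n * A + D := by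
    have hsub : Tendsto (fun n : ℕ => n * N) atTop atTop :=
      tendsto_id.atTop_mul_const' hN
    filter_upwards [hsub.eventually ((topPressure_le_iff f ψ P).1 hP ε hε0 (P + δ)
      (by linarith))] with n hn
    have h := partitionEntropy_itinerary_le hf hμ ψ hζ hB hε0 hsep' hψ n N hn
    have h' := mul_le_mul_of_nonneg_left hbad (Nat.cast_nonneg (α := ℝ) n)
    push_cast at h
    rw [hA, hD]
    linarith
  have hbound : ∀ᶠ m : ℕ in atTop, partitionEntropy μ (itinerary f ξ m) / m ≤
      P + 2 * δ - I + (Real.log 2 + 1) / N + δ := by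
    have hdiv : Tendsto (fun m : ℕ => m / N + 1) atTop atTop :=
      (tendsto_add_atTop_nat 1).comp (Nat.tendsto_div_const_atTop hN.ne')
    -- Rounding `m` up to a multiple of `N` costs at most |A|, paid together with `D` by the last δ.
    have hlarge : ∀ᶠ m : ℕ in atTop, |A| + |D| ≤ m * δ :=
      (tendsto_natCast_atTop_atTop.atTop_mul_const hδ).eventually_ge_atTop _
    filter_upwards [hdiv.eventually hlin, hlarge, eventually_gt_atTop 0] with m hm hmδ hm0
    have hmN : m ≤ (m / N + 1) * N := by
      have := Nat.lt_div_mul_add hN (a := m)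
      nlinarith
    obtain ⟨G, hG⟩ := exists_itinerary_eq_comp f ξ hN hmN
    have hle : partitionEntropy μ (itinerary f ξ m) ≤ ((m / N + 1 : ℕ) : ℝ) * A + D := by
      rw [hG]
      exact (partitionEntropy_comp_le μ
        (measurableSet_itinerary_preimage (hf.iterate N).measurable hζ _) G).trans hm
    have hm0' : (0 : ℝ) < m := by exact_mod_cast hm0
    have hN' : (0 : ℝ) < N := by exact_mod_cast hN
    have hq1 : (m : ℝ) / N ≤ ((m / N + 1 : ℕ) : ℝ) := by
      rw [div_le_iff₀ hN']; exact_mod_cast hmN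
    have hq2 : ((m / N + 1 : ℕ) : ℝ) ≤ m / N + 1 := by
      push_cast
      linarith [Nat.cast_div_le (α := ℝ) (m := m) (n := N)]
    have hqA : ((m / N + 1 : ℕ) : ℝ) * A ≤ m / N * A + |A| := by
      have h1 := le_abs_self A
      have h2 : (((m / N + 1 : ℕ) : ℝ) - m / N) * A ≤ 1 * |A| :=
        (mul_le_mul_of_nonneg_left h1 (by linarith)).trans
          (mul_le_mul_of_nonneg_right (by linarith) (abs_nonneg A))
      linarith
    rw [div_le_iff₀ hm0']
    have hDD := le_abs_self D
    have e : (m : ℝ) / N * A = (P + 2 * δ - I + (Real.log 2 + 1) / N) * m := by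
      rw [hA]; field_simp; ring
    nlinarith
  refine limsup_le_of_le (h := ?_)
  filter_upwards [hbound] with m hm
  exact EReal.coe_le_coe_iff.2 hm

/-- The entropy of an invariant measure and the integral of a potential are bounded by the
pressure. -/
theorem metricEntropy_le {f : X → X} (hf : Continuous f) {μ : ProbabilityMeasure X}
    (hμ : μ ∈ invariantMeasures f) (ψ : C(X, ℝ)) {P : ℝ} (hP : topPressure f ψ ≤ (P : EReal)) :
    metricEntropy f μ ≤ ((P - ∫ x, ψ x ∂(μ : Measure X) : ℝ) : EReal) := by
  refine iSup_le fun k => iSup_le fun ξ => iSup_le fun hξ => ?_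
  -- Block length N + 1 and δ = 1/(N + 1) are sent to their limits together.
  have hlim : Tendsto (fun N : ℕ => ((P + 2 * (1 / ((N : ℝ) + 1)) - ∫ x, ψ x ∂(μ : Measure X) +
      (Real.log 2 + 1) / ((N + 1 : ℕ) : ℝ) + 1 / ((N : ℝ) + 1) : ℝ) : EReal)) atTop
      (𝓝 ((P - ∫ x, ψ x ∂(μ : Measure X) : ℝ) : EReal)) := by
    refine (continuous_coe_real_ereal.tendsto _).comp ?_
    have h1 := tendsto_one_div_add_atTop_nhds_zero_nat (𝕜 := ℝ)
    have h2 := (tendsto_const_div_atTop_nhds_zero_nat (Real.log 2 + 1)).comp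
      (tendsto_add_atTop_nat 1)
    have := (((h1.const_mul 2).const_add P).sub_const (∫ x, ψ x ∂(μ : Measure X))).add h2 |>.add h1
    simpa using this
  exact ge_of_tendsto' hlim fun N =>
    entropyOfPartition_le hf hμ ψ hξ hP (Nat.succ_pos N) Nat.one_div_pos_of_nat

end Ruelle

/-! ### Zero-temperature limits -/

section ZeroTemperature

variable {X : Type*} [MetricSpace X] [MeasurableSpace X]

lemma integral_smul_continuousMap (μ : ProbabilityMeasure X) (t : ℝ) (φ : C(X, ℝ)) :
    ∫ x, (t • φ) x ∂(μ : Measure X) = t * ∫ x, φ x ∂(μ : Measure X) := by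
  simp [integral_const_mul]

lemma mem_maximizingMeasures_iff {f : X → X} {φ : C(X, ℝ)} {m : ℝ}
    (hm : IsGreatest
      ((fun ν : ProbabilityMeasure X => ∫ x, φ x ∂(ν : Measure X)) '' invariantMeasures f) m)
    (μ : ProbabilityMeasure X) :
    μ ∈ maximizingMeasures f φ ↔
      μ ∈ invariantMeasures f ∧ ∫ x, φ x ∂(μ : Measure X) = m := by
  refine and_congr_right fun hμ => ⟨fun h => ?_, fun h ν hν => ?_⟩
  · obtain ⟨ν, hν, hνm⟩ := hm.1
    exact le_antisymm (hm.2 ⟨μ, hμ, rfl⟩) (hνm ▸ h ν hν)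
  · rw [h]
    exact hm.2 ⟨ν, hν, rfl⟩

variable [CompactSpace X]

lemma coe_le_varEntropy_iff [Nonempty X] {f : X → X} (hent : Dynamics.coverEntropy f Set.univ < ⊤)
    (μ : ProbabilityMeasure X) (c : ℝ) :
    (c : EReal) ≤ varEntropy f μ ↔
      ∀ ψ : C(X, ℝ), c + ∫ x, ψ x ∂(μ : Measure X) ≤ (topPressure f ψ).toReal := by
  rw [varEntropy, le_iInf_iff]
  refine forall_congr' fun ψ => ?_
  rw [← coe_toReal_topPressure hent ψ, ← EReal.coe_sub, EReal.coe_le_coe_iff, EReal.toReal_coe,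
    le_sub_iff_add_le]

lemma varEntropy_ne_top [Nonempty X] {f : X → X} (hent : Dynamics.coverEntropy f Set.univ < ⊤)
    (μ : ProbabilityMeasure X) : varEntropy f μ ≠ ⊤ := by
  refine ((iInf_le _ (0 : C(X, ℝ))).trans_lt ?_).ne
  rw [← coe_toReal_topPressure hent, ← EReal.coe_sub]
  exact EReal.coe_lt_top _

variable [BorelSpace X]

lemma isClosed_invariantMeasures {f : X → X} (hf : Continuous f) :
    IsClosed (invariantMeasures f) := by
  have : invariantMeasures f = ⋂ g : C(X, ℝ), {μ : ProbabilityMeasure X |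
      ∫ x, g (f x) ∂(μ : Measure X) = ∫ x, g x ∂(μ : Measure X)} := by
    ext μ
    simp [mem_invariantMeasures_iff hf]
  rw [this]
  exact isClosed_iInter fun g => isClosed_eq
    (ProbabilityMeasure.continuous_integral_continuousMap (g.comp ⟨f, hf⟩))
    (ProbabilityMeasure.continuous_integral_continuousMap g)

lemma mem_invariantMeasures_of_mapClusterPt {f : X → X} {φ : C(X, ℝ)}
    {ν : ℝ → ProbabilityMeasure X} {ν' : ProbabilityMeasure X} (hf : Continuous f)
    (hν : ∀ t : ℝ, 0 < t → IsEquilibriumState f (t • φ) (ν t))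
    (hν' : MapClusterPt ν' atTop ν) : ν' ∈ invariantMeasures f :=
  (isClosed_invariantMeasures hf).mem_of_mapClusterPt hν'
    ((eventually_gt_atTop 0).mono fun t ht => (hν t ht).1)

variable [Nonempty X] {f : X → X}

/-- The variational entropy of an invariant measure dominates its metric entropy. -/
lemma metricEntropy_le_varEntropy (hf : Continuous f)
    (hent : Dynamics.coverEntropy f Set.univ < ⊤) {μ : ProbabilityMeasure X}
    (hμ : μ ∈ invariantMeasures f) : metricEntropy f μ ≤ varEntropy f μ := by
  refine le_iInf fun ψ => ?_
  rw [← coe_toReal_topPressure hent ψ, ← EReal.coe_sub]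
  exact metricEntropy_le hf hμ ψ (coe_toReal_topPressure hent ψ).ge

/-- Invariance matters here: it gives 0 ≤ h_μ ≤ 𝔥_μ. -/
lemma varEntropy_ne_bot (hf : Continuous f) (hent : Dynamics.coverEntropy f Set.univ < ⊤)
    {μ : ProbabilityMeasure X} (hμ : μ ∈ invariantMeasures f) : varEntropy f μ ≠ ⊥ :=
  (EReal.bot_lt_zero.trans_le
    ((metricEntropy_nonneg f μ).trans (metricEntropy_le_varEntropy hf hent hμ))).ne'

lemma coe_toReal_varEntropy (hf : Continuous f) (hent : Dynamics.coverEntropy f Set.univ < ⊤)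
    {μ : ProbabilityMeasure X} (hμ : μ ∈ invariantMeasures f) :
    ((varEntropy f μ).toReal : EReal) = varEntropy f μ :=
  EReal.coe_toReal (varEntropy_ne_top hent μ) (varEntropy_ne_bot hf hent hμ)

lemma toReal_varEntropy_add_integral_le (hf : Continuous f)
    (hent : Dynamics.coverEntropy f Set.univ < ⊤) {μ : ProbabilityMeasure X}
    (hμ : μ ∈ invariantMeasures f) (t : ℝ) (φ : C(X, ℝ)) :
    (varEntropy f μ).toReal + t * ∫ x, φ x ∂(μ : Measure X) ≤
      (topPressure f (t • φ)).toReal := by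
  rw [← integral_smul_continuousMap]
  exact (coe_le_varEntropy_iff hent μ _).1 (coe_toReal_varEntropy hf hent hμ).le _

lemma IsEquilibriumState.toReal_topPressure_eq (hf : Continuous f)
    (hent : Dynamics.coverEntropy f Set.univ < ⊤) {μ : ProbabilityMeasure X} {t : ℝ} {φ : C(X, ℝ)}
    (h : IsEquilibriumState f (t • φ) μ) :
    (topPressure f (t • φ)).toReal =
      (varEntropy f μ).toReal + t * ∫ x, φ x ∂(μ : Measure X) := by
  rw [h.2, ← coe_toReal_varEntropy hf hent h.1, ← EReal.coe_add, EReal.toReal_coe,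
    EReal.toReal_coe, integral_smul_continuousMap]

/-- The variational principle for `t • φ`, normalized by `t`. -/
theorem isGreatest_topPressure (hf : Continuous f)
    (hent : Dynamics.coverEntropy f Set.univ < ⊤) (φ : C(X, ℝ)) {t : ℝ} (ht : 0 < t) :
    IsGreatest
      ((fun ν : ProbabilityMeasure X =>
          ((1 / t : ℝ) : EReal) * varEntropy f ν
            + ((∫ x, φ x ∂(ν : Measure X) : ℝ) : EReal)) '' invariantMeasures f)
      (((1 / t : ℝ) : EReal) * topPressure f (t • φ)) := by
  constructor
  · obtain ⟨ν, hν⟩ := exists_isEquilibriumState hf hent (t • φ)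
    refine ⟨ν, hν.1, ?_⟩
    simp only
    rw [← coe_toReal_topPressure hent, hν.toReal_topPressure_eq hf hent,
      ← coe_toReal_varEntropy hf hent hν.1, ← EReal.coe_mul, ← EReal.coe_mul, ← EReal.coe_add,
      EReal.toReal_coe]
    congr 1
    field_simp
  · rintro _ ⟨ν, hν, rfl⟩
    simp only
    rw [← coe_toReal_topPressure hent, ← coe_toReal_varEntropy hf hent hν, ← EReal.coe_mul,
      ← EReal.coe_mul, ← EReal.coe_add, EReal.coe_le_coe_iff]
    have h := mul_le_mul_of_nonneg_left (toReal_varEntropy_add_integral_le hf hent hν t φ)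
      (one_div_pos.2 ht).le
    refine le_trans (le_of_eq ?_) h
    field_simp

lemma exists_isGreatest_integral (hf : Continuous f)
    (hent : Dynamics.coverEntropy f Set.univ < ⊤) (φ : C(X, ℝ)) :
    ∃ m : ℝ, IsGreatest
      ((fun ν : ProbabilityMeasure X => ∫ x, φ x ∂(ν : Measure X)) '' invariantMeasures f) m := by
  obtain ⟨ν, hν⟩ := exists_isEquilibriumState hf hent φ
  exact ((isClosed_invariantMeasures hf).isCompact.image
    (ProbabilityMeasure.continuous_integral_continuousMap φ)).exists_isGreatest ⟨_, ν, hν.1, rfl⟩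

variable {φ : C(X, ℝ)} {m : ℝ}

/-- A maximizing measure with 𝔥 ≥ 0 gives the lower bound `m`; equilibrium states with 𝔥 ≤ P(0) give
the upper bound m + P(0)/t. -/
theorem tendsto_topPressure_smul_div (hf : Continuous f)
    (hent : Dynamics.coverEntropy f Set.univ < ⊤)
    (hm : IsGreatest
      ((fun ν : ProbabilityMeasure X => ∫ x, φ x ∂(ν : Measure X)) '' invariantMeasures f) m) :
    Tendsto (fun t : ℝ => ((1 / t : ℝ) : EReal) * topPressure f (t • φ)) atTop
      (𝓝 (m : EReal)) := by
  have hreal : Tendsto (fun t : ℝ => 1 / t * (topPressure f (t • φ)).toReal) atTop (𝓝 m) := by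
    have hup : Tendsto (fun t : ℝ => m + (topPressure f ((0 : ℝ) • φ)).toReal / t) atTop
        (𝓝 m) := by
      simpa using (tendsto_id.const_div_atTop (topPressure f ((0 : ℝ) • φ)).toReal).const_add m
    refine tendsto_of_tendsto_of_tendsto_of_le_of_le' tendsto_const_nhds hup ?_ ?_
    · filter_upwards [eventually_gt_atTop 0] with t ht
      obtain ⟨μ, hμ, hμm⟩ := hm.1
      simp only at hμm
      have h0 : 0 ≤ (varEntropy f μ).toReal := EReal.toReal_nonneg
        ((metricEntropy_nonneg f μ).trans (metricEntropy_le_varEntropy hf hent hμ))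
      have h := toReal_varEntropy_add_integral_le hf hent hμ t φ
      rw [one_div, ← div_eq_inv_mul, le_div_iff₀ ht, ← hμm]
      linarith
    · filter_upwards [eventually_gt_atTop 0] with t ht
      obtain ⟨ν, hν⟩ := exists_isEquilibriumState hf hent (t • φ)
      have h := toReal_varEntropy_add_integral_le hf hent hν.1 0 φ
      have hle : ∫ x, φ x ∂(ν : Measure X) ≤ m := hm.2 ⟨ν, hν.1, rfl⟩
      rw [hν.toReal_topPressure_eq hf hent, one_div, ← div_eq_inv_mul, div_le_iff₀ ht, add_mul,
        div_mul_cancel₀ _ ht.ne']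
      nlinarith
  refine ((continuous_coe_real_ereal.tendsto m).comp hreal).congr fun t => ?_
  simp only [Function.comp_apply]
  rw [EReal.coe_mul, coe_toReal_topPressure hent]

/-- If the variational entropies of a family of measures are eventually at least `c`, so is the
variational entropy of every accumulation point. -/
lemma le_varEntropy_of_mapClusterPt (hent : Dynamics.coverEntropy f Set.univ < ⊤)
    {ν : ℝ → ProbabilityMeasure X} {ν' : ProbabilityMeasure X} (hν' : MapClusterPt ν' atTop ν)
    {c : ℝ} (h : ∀ᶠ t in atTop, (c : EReal) ≤ varEntropy f (ν t)) :
    (c : EReal) ≤ varEntropy f ν' := by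
  -- Upper semicontinuity: a superlevel set is cut out by closed weak* conditions, one for each
  -- potential.
  have hclosed : IsClosed {μ : ProbabilityMeasure X | (c : EReal) ≤ varEntropy f μ} := by
    simp only [coe_le_varEntropy_iff hent, Set.ofPred_forall]
    exact isClosed_iInter fun ψ => isClosed_le
      (continuous_const.add (ProbabilityMeasure.continuous_integral_continuousMap ψ))
      continuous_const
  exact hclosed.mem_of_mapClusterPt hν' h

/-! ### Accumulation points of families of equilibrium states -/

section Family

variable {ν : ℝ → ProbabilityMeasure X} {ν' : ProbabilityMeasure X}

/-- For maximizing μ, tm ≤ P(tφ) = 𝔥(ν_t) + t ∫ φ dν_t ≤ P(0) + t ∫ φ dν_t, so the integrals along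
the family eventually exceed m - η for each η > 0. -/
lemma integral_eq_of_mapClusterPt (hf : Continuous f)
    (hent : Dynamics.coverEntropy f Set.univ < ⊤)
    (hm : IsGreatest
      ((fun ν : ProbabilityMeasure X => ∫ x, φ x ∂(ν : Measure X)) '' invariantMeasures f) m)
    (hν : ∀ t : ℝ, 0 < t → IsEquilibriumState f (t • φ) (ν t))
    (hν' : MapClusterPt ν' atTop ν) : ∫ x, φ x ∂(ν' : Measure X) = m := by
  refine le_antisymm (hm.2 ⟨ν', mem_invariantMeasures_of_mapClusterPt hf hν hν', rfl⟩) ?_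
  refine le_of_forall_sub_le fun η hη => ?_
  have hclosed : IsClosed {μ : ProbabilityMeasure X | m - η ≤ ∫ x, φ x ∂(μ : Measure X)} :=
    isClosed_le continuous_const (ProbabilityMeasure.continuous_integral_continuousMap φ)
  refine hclosed.mem_of_mapClusterPt hν' ?_
  filter_upwards [eventually_gt_atTop 0, (tendsto_id.atTop_mul_const hη).eventually_ge_atTop
    (topPressure f ((0 : ℝ) • φ)).toReal] with t ht htη
  simp only [id_eq] at htη
  obtain ⟨μ, hμ, hμm⟩ := hm.1
  simp only at hμm
  have h0 : 0 ≤ (varEntropy f μ).toReal := EReal.toReal_nonneg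
    ((metricEntropy_nonneg f μ).trans (metricEntropy_le_varEntropy hf hent hμ))
  have h1 := toReal_varEntropy_add_integral_le hf hent hμ t φ
  have h2 := toReal_varEntropy_add_integral_le hf hent (hν t ht).1 0 φ
  rw [(hν t ht).toReal_topPressure_eq hf hent, hμm] at h1
  have h3 : t * (m - η) ≤ t * ∫ x, φ x ∂(ν t : Measure X) := by linarith
  exact le_of_mul_le_mul_left h3 ht

/-- Equilibrium states have at least the variational entropy of any maximizing measure. -/
lemma IsEquilibriumState.varEntropy_le (hf : Continuous f)
    (hent : Dynamics.coverEntropy f Set.univ < ⊤) {t : ℝ} (ht : 0 < t)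
    {ν μ : ProbabilityMeasure X} (hν : IsEquilibriumState f (t • φ) ν)
    (hμ : μ ∈ maximizingMeasures f φ) : varEntropy f μ ≤ varEntropy f ν := by
  rw [← coe_toReal_varEntropy hf hent hμ.1, ← coe_toReal_varEntropy hf hent hν.1,
    EReal.coe_le_coe_iff]
  have h1 := toReal_varEntropy_add_integral_le hf hent hμ.1 t φ
  rw [hν.toReal_topPressure_eq hf hent] at h1
  have h2 := mul_le_mul_of_nonneg_left (hμ.2 ν hν.1) ht.le
  linarith

lemma varEntropy_le_of_mapClusterPt (hf : Continuous f)
    (hent : Dynamics.coverEntropy f Set.univ < ⊤)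
    (hν : ∀ t : ℝ, 0 < t → IsEquilibriumState f (t • φ) (ν t)) (hν' : MapClusterPt ν' atTop ν)
    {μ : ProbabilityMeasure X} (hμ : μ ∈ maximizingMeasures f φ) :
    varEntropy f μ ≤ varEntropy f ν' := by
  rw [← coe_toReal_varEntropy hf hent hμ.1]
  refine le_varEntropy_of_mapClusterPt hent hν' ?_
  filter_upwards [eventually_gt_atTop 0] with t ht
  rw [coe_toReal_varEntropy hf hent hμ.1]
  exact (hν t ht).varEntropy_le hf hent ht hμ

/-- The variational entropy of equilibrium states for `t • φ` does not increase with `t`. -/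
lemma IsEquilibriumState.varEntropy_le_of_lt (hf : Continuous f)
    (hent : Dynamics.coverEntropy f Set.univ < ⊤) {s t : ℝ} (hs : 0 < s) (hst : s < t)
    {μ ν : ProbabilityMeasure X} (hμ : IsEquilibriumState f (s • φ) μ)
    (hν : IsEquilibriumState f (t • φ) ν) : varEntropy f ν ≤ varEntropy f μ := by
  rw [← coe_toReal_varEntropy hf hent hμ.1, ← coe_toReal_varEntropy hf hent hν.1,
    EReal.coe_le_coe_iff]
  have h1 := toReal_varEntropy_add_integral_le hf hent hν.1 s φ
  have h2 := toReal_varEntropy_add_integral_le hf hent hμ.1 t φ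
  rw [hμ.toReal_topPressure_eq hf hent] at h1
  rw [hν.toReal_topPressure_eq hf hent] at h2
  have h3 : 0 ≤ (t - s) * (∫ x, φ x ∂(ν : Measure X) - ∫ x, φ x ∂(μ : Measure X)) := by
    linarith
  -- Adding the two optimality inequalities cancels the entropies, so ∫ φ grows with the parameter;
  -- optimality at `s` then makes the entropy drop.
  have h4 := nonneg_of_mul_nonneg_right h3 (sub_pos.2 hst)
  nlinarith

/-- Variational entropies converge along a family of equilibrium states with an accumulation
point. -/
theorem tendsto_varEntropy_of_mapClusterPt (hf : Continuous f)
    (hent : Dynamics.coverEntropy f Set.univ < ⊤)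
    (hν : ∀ t : ℝ, 0 < t → IsEquilibriumState f (t • φ) (ν t)) (hν' : MapClusterPt ν' atTop ν)
    (hmax : ν' ∈ maximizingMeasures f φ) :
    Tendsto (fun t : ℝ => varEntropy f (ν t)) atTop (𝓝 (varEntropy f ν')) := by
  refine tendsto_order.2 ⟨fun a ha => ?_, fun b hb => ?_⟩
  · filter_upwards [eventually_gt_atTop 0] with t ht
    exact ha.trans_le ((hν t ht).varEntropy_le hf hent ht hmax)
  · obtain ⟨c, hc, hcb⟩ := EReal.lt_iff_exists_real_btwn.1 hb
    by_contra hfreq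
    rw [not_eventually] at hfreq
    refine hc.not_ge (le_varEntropy_of_mapClusterPt hent hν' ?_)
    -- Monotonicity upgrades large values at arbitrarily late times to large values at every time,
    -- so semicontinuity at one accumulation point suffices.
    filter_upwards [eventually_gt_atTop 0] with s hs
    obtain ⟨t, htb, hst⟩ := (hfreq.and_eventually (eventually_gt_atTop s)).exists
    exact (hcb.le.trans (not_lt.1 htb)).trans
      ((hν s hs).varEntropy_le_of_lt hf hent hs hst (hν t (hs.trans hst)))

end Family

end ZeroTemperature

end VariationalEntropy

theorem mainTheorem8 {X : Type*} [MetricSpace X] [CompactSpace X] [Nonempty X]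
    [MeasurableSpace X] [BorelSpace X] (f : X → X) (hf : Continuous f)
    (hent : Dynamics.coverEntropy f Set.univ < ⊤) (φ : C(X, ℝ)) :
    (∀ ν ∈ invariantMeasures f, varEntropy f ν ≠ ⊥ ∧ varEntropy f ν ≠ ⊤) ∧
    (∀ t : ℝ, 0 < t →
      IsGreatest
        ((fun ν : ProbabilityMeasure X =>
            ((1 / t : ℝ) : EReal) * varEntropy f ν
              + ((∫ x, φ x ∂(ν : Measure X) : ℝ) : EReal)) '' invariantMeasures f)
        (((1 / t : ℝ) : EReal) * topPressure f (t • φ))) ∧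
    ∃ m : ℝ,
      IsGreatest
        ((fun ν : ProbabilityMeasure X => ∫ x, φ x ∂(ν : Measure X)) '' invariantMeasures f) m ∧
      Tendsto (fun t : ℝ => ((1 / t : ℝ) : EReal) * topPressure f (t • φ)) atTop
        (𝓝 (m : EReal)) ∧
      ∀ ν : ℝ → ProbabilityMeasure X,
        (∀ t : ℝ, 0 < t → IsEquilibriumState f (t • φ) (ν t)) →
        ∀ ν' : ProbabilityMeasure X, MapClusterPt ν' atTop ν →
          ν' ∈ invariantMeasures f ∧
          ∫ x, φ x ∂(ν' : Measure X) = m ∧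
          IsGreatest (varEntropy f '' maximizingMeasures f φ) (varEntropy f ν') ∧
          IsGreatest (varEntropy f '' zeroTempMeasures f φ) (varEntropy f ν') ∧
          (⨆ μ ∈ maximizingMeasures f φ, metricEntropy f μ) ≤ varEntropy f ν' ∧
          Tendsto (fun t : ℝ => varEntropy f (ν t)) atTop (𝓝 (varEntropy f ν')) := by
  refine ⟨fun ν hν => ⟨varEntropy_ne_bot hf hent hν, varEntropy_ne_top hent ν⟩,
    fun t ht => isGreatest_topPressure hf hent φ ht, ?_⟩
  obtain ⟨m, hm⟩ := exists_isGreatest_integral hf hent φ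
  refine ⟨m, hm, tendsto_topPressure_smul_div hf hent hm, fun ν hν ν' hν' => ?_⟩
  have hinv := mem_invariantMeasures_of_mapClusterPt hf hν hν'
  have hint := integral_eq_of_mapClusterPt hf hent hm hν hν'
  have hmax : ν' ∈ maximizingMeasures f φ := (mem_maximizingMeasures_iff hm ν').2 ⟨hinv, hint⟩
  have hle : ∀ μ ∈ maximizingMeasures f φ, varEntropy f μ ≤ varEntropy f ν' := fun μ hμ =>
    varEntropy_le_of_mapClusterPt hf hent hν hν' hμ
  refine ⟨hinv, hint, ⟨⟨ν', hmax, rfl⟩, ?_⟩, ⟨⟨ν', ⟨hmax, ν, hν, hν'⟩, rfl⟩, ?_⟩, ?_,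
    tendsto_varEntropy_of_mapClusterPt hf hent hν hν' hmax⟩
  · rintro _ ⟨μ, hμ, rfl⟩
    exact hle μ hμ
  · rintro _ ⟨μ, hμ, rfl⟩
    exact hle μ hμ.1
  · exact iSup₂_le fun μ hμ => (metricEntropy_le_varEntropy hf hent hμ.1).trans (hle μ hμ)
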